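/- Fix an o-minimal structure $\mathcal O=(\mathcal O_p)_{p\in\mathbb N}$ on $(\mathbb R,+,\cdot)$: each $\mathcal O_p$ is a Boolean algebra of subsets of $\mathbb R^p$ (the definable sets) containing all real algebraic sets; $A\in\mathcal O_p$ implies $A\times\mathbb R,\ \mathbb R\times A\in\mathcal O_{p+1}$; the projection on the first $p$ coordinates of a set in $\mathcal O_{p+1}$ is in $\mathcal O_p$; and $\mathcal O_1$ consists exactly of the finite unions of intervals. A function is definable if its graph is. Let $(\Omega,X,Y,g,\rho)$ be a zero-sum stochastic game with finite state set $\Omega$, nonempty compact definable action sets $X\subset\mathbb R^p$ and $Y\subset\mathbb R^q$, an arbitrary continuous reward function $g:\Omega\times X\times Y\to\mathbb R$, and a continuous transition function $\rho:\Omega\times X\times Y\to\Delta(\Omega)$, where $\Delta(\cdot)$ denotes the set of probability measures. Assume that $\rho$ is definable and separable, i.e. for all $\omega,\omega'\in\Omega$ the function $(x,y)\mapsto\rho(\omega'\mid x,y,\omega)$ is definable and is a finite sum $\sum_{i}\sum_{j} n_{ij}\,c_i(x)\,d_j(y)$ with $n_{ij}\in\mathbb R$ and continuous functions $c_i:X\to\mathbb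 R$, $d_j:Y\to\mathbb R$. At each stage $i\ge 1$ both players know the current state $\omega_i$ and all past states and actions, choose independently (possibly at random) actions $x_i\in X$, $y_i\in Y$, the stage payoff is $g_i=g(x_i,y_i,\omega_i)$, and $\omega_{i+1}$ is drawn from $\rho(\cdot\mid x_i,y_i,\omega_i)$. Strategies $\sigma,\tau$ of Players 1 and 2 are (measurable) maps from finite histories in $\bigcup_{n\ge0}(\Omega\times X\times Y)^n\times\Omega$ to $\Delta(X)$ and $\Delta(Y)$ respectively; together with an initial state $\omega$ they induce a probability on infinite plays, with expectation $\mathbb E_{\sigma,\tau,\omega}$. Player 1 maximizes, and Player 2 minimizes, the payoff $$\gamma_n(\sigma,\tau,\omega)=\frac1n\,\mathbb E_{\sigma,\tau,\omega}\Big(\sum_{i=1}^n g_i\Big)\quad(n\ge1)\qquad\text{resp.}\qquad \gamma_\lambda(\sigma,\tau,\omega)=\mathbb E_{\sigma,\tau,\omega}\Big(\lambda\sum_{i\ge1}(1-\lambda)^{i-1}g_i\Big)\quad(0<\lambda\le1).$$ Then for every initial state $\omega$ the $n$-stage game has a value $v_n(\omega)=\sup_\sigma\inf_\tau\gamma_n=\inf_\tau\sup_\sigma\gamma_n$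 for each $n\ge1$, the discounted game has a value $v_\lambda(\omega)=\sup_\sigma\inf_\tau\gamma_\lambda=\inf_\tau\sup_\sigma\gamma_\lambda$ for each $\lambda\in(0,1]$, and the limits of the vectors $v_n,v_\lambda\in\mathbb R^\Omega$ exist and coincide: $$\lim_{n\to\infty}v_n=\lim_{\lambda\to0^+}v_\lambda .$$ -/

import Mathlib

open Set Filter Topology MeasureTheory ProbabilityTheory
open scoped ENNReal

/-- An o-minimal structure on the real field `(ℝ, +, ·)`: `sets p` is the collection of definable
subsets of `ℝ ^ p`. -/
structure OMinStructure where
  /-- the definable subsets of `ℝ ^ p` -/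
  sets : (p : ℕ) → Set (Set (Fin p → ℝ))
  /-- each `sets p` is a Boolean algebra of subsets of `ℝ ^ p` -/
  empty_mem : ∀ p, ∅ ∈ sets p
  compl_mem : ∀ p, ∀ A ∈ sets p, Aᶜ ∈ sets p
  union_mem : ∀ p, ∀ A ∈ sets p, ∀ B ∈ sets p, A ∪ B ∈ sets p
  /-- `A × ℝ` is definable -/
  prod_univ_mem : ∀ p, ∀ A ∈ sets p, {z : Fin (p + 1) → ℝ | Fin.init z ∈ A} ∈ sets (p + 1)
  /-- `ℝ × A` is definable -/
  univ_prod_mem : ∀ p, ∀ A ∈ sets p, {z : Fin (p + 1) → ℝ | Fin.tail z ∈ A} ∈ sets (p + 1)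
  /-- the projection of a definable set on the first `p` coordinates is definable -/
  proj_mem : ∀ p, ∀ A ∈ sets (p + 1), (fun z : Fin (p + 1) → ℝ => Fin.init z) '' A ∈ sets p
  /-- real algebraic sets are definable -/
  algebraic_mem : ∀ p, ∀ P : MvPolynomial (Fin p) ℝ,
    {x : Fin p → ℝ | MvPolynomial.eval x P = 0} ∈ sets p
  /-- the definable subsets of `ℝ` are exactly the finite unions of intervals (the order-connected
  subsets of `ℝ` are the intervals of all kinds, points and the empty set included) -/
  mem_one_iff : ∀ A : Set (Fin 1 → ℝ), A ∈ sets 1 ↔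
    ∃ F : Set (Set ℝ), F.Finite ∧ (∀ I ∈ F, I.OrdConnected) ∧ A = {x | x 0 ∈ ⋃₀ F}

/-- A real function `f` on `X × Y`, where `X ⊆ ℝ ^ p` and `Y ⊆ ℝ ^ q`, is definable when its graph
`{(x, y, f x y)}` is a definable subset of `ℝ ^ (p + q + 1)`. -/
def OMinStructure.DefinableFun (O : OMinStructure) {p q : ℕ}
    {X : Set (Fin p → ℝ)} {Y : Set (Fin q → ℝ)} (f : X → Y → ℝ) : Prop :=
  {z : Fin (p + q + 1) → ℝ | ∃ (x : X) (y : Y),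
    z = Fin.append (Fin.append (x : Fin p → ℝ) (y : Fin q → ℝ)) ![f x y]} ∈ O.sets (p + q + 1)

/-- A separable function: a finite sum `∑ i, ∑ j, m i j * a i x * b j y` with continuous `a i`
and `b j` and real coefficients `m i j`. -/
def IsSeparableFun {A B : Type*} [TopologicalSpace A] [TopologicalSpace B] (f : A → B → ℝ) : Prop :=
  ∃ (I J : ℕ) (m : Fin I → Fin J → ℝ) (a : Fin I → A → ℝ) (b : Fin J → B → ℝ),
    (∀ i, Continuous (a i)) ∧ (∀ j, Continuous (b j)) ∧
      ∀ x y, f x y = ∑ i, ∑ j, m i j * a i x * b j y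

/-- A zero-sum stochastic game with finite state space `Ω`, nonempty compact action sets
`X ⊆ ℝ ^ p`, `Y ⊆ ℝ ^ q`, continuous reward `g` and continuous transition probability `ρ`
(`ρ ω x y ω'` is the probability of moving from `ω` to `ω'`). -/
structure StochasticGame (Ω : Type*) [Fintype Ω] (p q : ℕ) where
  X : Set (Fin p → ℝ)
  Y : Set (Fin q → ℝ)
  isCompact_X : IsCompact X
  isCompact_Y : IsCompact Y
  nonempty_X : X.Nonempty
  nonempty_Y : Y.Nonempty
  g : Ω → X → Y → ℝ
  ρ : Ω → X → Y → stdSimplex ℝ Ω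
  continuous_g : ∀ ω, Continuous fun a : X × Y => g ω a.1 a.2
  continuous_ρ : ∀ ω, Continuous fun a : X × Y => ρ ω a.1 a.2

namespace StochasticGame

variable {Ω : Type*} [Fintype Ω] {p q : ℕ}

/-- What happens at one stage: the current state and the two actions. -/
abbrev Stage (G : StochasticGame Ω p q) : Type _ := Ω × G.X × G.Y

/-- The histories after `n` stages, `(Ω × X × Y) ^ n × Ω`: the past stages and the current state. -/
abbrev Hist (G : StochasticGame Ω p q) (n : ℕ) : Type _ := (Fin n → G.Stage) × Ω

/-- The reward at a stage. -/
def reward (G : StochasticGame Ω p q) (s : G.Stage) : ℝ := G.g s.1 s.2.1 s.2.2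

/-- The value of a zero-sum game with payoff `γ`, the first player maximizing: `v` is the common
value of `sup inf γ` and `inf sup γ`. -/
def IsValue {S T : Type*} (γ : S → T → ℝ) (v : ℝ) : Prop :=
  ∀ ε > 0, (∃ σ, ∀ τ, v - ε ≤ γ σ τ) ∧ (∃ τ, ∀ σ, γ σ τ ≤ v + ε)

variable [MeasurableSpace Ω] [MeasurableSingletonClass Ω]

/-- A (behavioural) strategy with values in the action set `A`: a probability on `A` for every
finite history, depending measurably on the history. -/
structure Strategy (G : StochasticGame Ω p q) (A : Type*) [MeasurableSpace A] where
  toKernel : (n : ℕ) → Kernel (G.Hist n) A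
  isMarkov : ∀ n, IsMarkovKernel (toKernel n)

attribute [instance] Strategy.isMarkov

lemma measurable_transition (G : StochasticGame Ω p q) (ω' : Ω) :
    Measurable fun s : G.Stage => G.ρ s.1 s.2.1 s.2.2 ω' := by
  refine measurable_from_prod_countable_right fun ω => ?_
  have h : Continuous fun a : G.X × G.Y => (G.ρ ω a.1 a.2 : Ω → ℝ) ω' :=
    (continuous_apply ω').comp (continuous_subtype_val.comp (G.continuous_ρ ω))
  exact h.measurable

/-- The law of the next state, given the current stage. -/
noncomputable def transition (G : StochasticGame Ω p q) : Kernel G.Stage Ω where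
  toFun s := ∑ ω', ENNReal.ofReal (G.ρ s.1 s.2.1 s.2.2 ω') • Measure.dirac ω'
  measurable' := by
    refine Measure.measurable_of_measurable_coe _ fun t _ => ?_
    simp only [Measure.coe_finsetSum, Finset.sum_apply, Measure.smul_apply, smul_eq_mul]
    exact Finset.measurable_sum _ fun ω' _ =>
      (G.measurable_transition ω').ennreal_ofReal.mul_const _

instance (G : StochasticGame Ω p q) : IsMarkovKernel G.transition where
  isProbabilityMeasure s := ⟨by
    have h := (G.ρ s.1 s.2.1 s.2.2).2
    change (∑ ω', ENNReal.ofReal (G.ρ s.1 s.2.1 s.2.2 ω') • Measure.dirac ω') univ = 1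
    simp only [Measure.coe_finsetSum, Finset.sum_apply, Measure.smul_apply, smul_eq_mul,
      measure_univ, mul_one]
    have h1 : ∑ ω', G.ρ s.1 s.2.1 s.2.2 ω' = 1 := h.2
    have h0 : ∀ ω', 0 ≤ G.ρ s.1 s.2.1 s.2.2 ω' := h.1
    rw [← ENNReal.ofReal_sum_of_nonneg fun ω' _ => h0 ω', h1, ENNReal.ofReal_one]⟩

/-- The law of a stage given the history before it: the state is the current one, and the two
actions are drawn independently according to the strategies. -/
noncomputable def stageKernel (G : StochasticGame Ω p q) (σ : G.Strategy G.X) (τ : G.Strategy G.Y)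
    (n : ℕ) : Kernel (G.Hist n) G.Stage :=
  Kernel.deterministic Prod.snd measurable_snd ×ₖ (σ.toKernel n ×ₖ τ.toKernel n)

instance (G : StochasticGame Ω p q) (σ : G.Strategy G.X) (τ : G.Strategy G.Y) (n : ℕ) :
    IsMarkovKernel (G.stageKernel σ τ n) := by
  unfold stageKernel; infer_instance

/-- From the stages `0, …, n` to the history after these `n + 1` stages: the new state is drawn
according to the transition probability at stage `n`. -/
noncomputable def histKernel (G : StochasticGame Ω p q) (n : ℕ) :
    Kernel (Finset.Iic n → G.Stage) (G.Hist (n + 1)) :=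
  Kernel.deterministic
      (fun (h : Finset.Iic n → G.Stage) (i : Fin (n + 1)) =>
        h ⟨i, Finset.mem_Iic.2 (Nat.le_of_lt_succ i.2)⟩)
      (measurable_pi_lambda _ fun _ => measurable_pi_apply _) ×ₖ
    G.transition.comap (fun h => h ⟨n, Finset.mem_Iic.2 le_rfl⟩) (measurable_pi_apply _)

instance (G : StochasticGame Ω p q) (n : ℕ) : IsMarkovKernel (G.histKernel n) := by
  unfold histKernel; infer_instance

/-- The law of stage `n + 1` given the stages `0, …, n`. -/
noncomputable def nextStage (G : StochasticGame Ω p q) (σ : G.Strategy G.X) (τ : G.Strategy G.Y)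
    (n : ℕ) : Kernel (Finset.Iic n → G.Stage) G.Stage :=
  G.stageKernel σ τ (n + 1) ∘ₖ G.histKernel n

instance (G : StochasticGame Ω p q) (σ : G.Strategy G.X) (τ : G.Strategy G.Y) (n : ℕ) :
    IsMarkovKernel (G.nextStage σ τ n) := by
  unfold nextStage; infer_instance

/-- The probability on the set `(Ω × X × Y) ^ ℕ` of infinite plays induced by a pair of strategies
and an initial state (Ionescu-Tulcea); the first stage has index `0`. -/
noncomputable def playMeasure (G : StochasticGame Ω p q) (σ : G.Strategy G.X) (τ : G.Strategy G.Y)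
    (ω : Ω) : Measure (ℕ → G.Stage) :=
  Kernel.trajMeasure (X := fun _ => G.Stage) (G.stageKernel σ τ 0 (Fin.elim0, ω))
    (G.nextStage σ τ)

/-- The payoff of the `n`-stage game: the expected mean reward over the first `n` stages. -/
noncomputable def payoffN (G : StochasticGame Ω p q) (n : ℕ) (ω : Ω)
    (σ : G.Strategy G.X) (τ : G.Strategy G.Y) : ℝ :=
  1 / (n : ℝ) * ∫ h, ∑ i ∈ Finset.range n, G.reward (h i) ∂(G.playMeasure σ τ ω)

/-- The payoff of the `lam`-discounted game. -/
noncomputable def payoffDisc (G : StochasticGame Ω p q) (lam : ℝ) (ω : Ω)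
    (σ : G.Strategy G.X) (τ : G.Strategy G.Y) : ℝ :=
  ∫ h, lam * ∑' i : ℕ, (1 - lam) ^ i * G.reward (h i) ∂(G.playMeasure σ τ ω)

end StochasticGame

/-! The values are governed by Shapley's one-shot equations: the total value `V (n + 1)` is the
mixed value of `g + E[V n]`, and the discounted value `w lam` is the fixed point of `w = val (lam *
g + (1 - lam) * E[w])`. Compact continuous games have mixed values by discretization and the finite
minimax theorem, so both equations can be solved; Markov strategies built from nearly optimal
one-shot actions then guarantee these numbers in the repeated game.

Changing the reward by at most `ε` moves `V n / n` and `w lam` by at most `ε`, uniformly in `n` and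
`lam`, so by Stone–Weierstrass the asymptotics may be studied for polynomial rewards
(`exists_polyReward_near`).

For a polynomial reward and a separable transition, the partial functions of the one-shot payoff
stay in a finite-dimensional space which does not depend on `lam` or on the continuation vector. By
Carathéodory's theorem, mixed actions carried by a fixed number of points suffice. Such actions are
finite tuples of reals, so Shapley's equation becomes a first-order formula over the o-minimal
structure (`defPred_isDiscValue`). Its solution is unique, hence any definable comparison involving
`w lam` is eventually true or eventually false as `lam` tends to `0` from the right. Comparison with
constants gives convergence of `w`; comparison of `w lam` with `w (lam / (1 + lam))` makes `w (1 /
n)` eventually monotone in each state.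

Finally, the error `D n = ‖V n - n • w (1 / n)‖` grows at each step by at most `n * ‖w (1 / n) - w
(1 / (n + 1))‖`. Monotonicity turns these increments into differences of a sequence tending to `0`,
and summation by parts with Cesàro averaging yields `D n / n → 0` (`tendsto_div_of_increment_le`).
-/

/-! ### Mixed actions with finite support -/

/-- A probability on `A` carried by `n` (not necessarily distinct) points. -/
structure FinProb (n : ℕ) (A : Type*) where
  weight : Fin n → ℝ
  point : Fin n → A
  weight_nonneg : ∀ k, 0 ≤ weight k
  weight_sum : ∑ k, weight k = 1

namespace FinProb

variable {n m : ℕ} {A B : Type*}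

/-- The mean of a function. -/
def avg (μ : FinProb n A) (f : A → ℝ) : ℝ := ∑ k, μ.weight k * f (μ.point k)

lemma avg_const (μ : FinProb n A) (c : ℝ) : μ.avg (fun _ => c) = c := by
  simp [avg, ← Finset.sum_mul, μ.weight_sum]

lemma avg_mono (μ : FinProb n A) {f g : A → ℝ} (h : ∀ x, f x ≤ g x) : μ.avg f ≤ μ.avg g :=
  Finset.sum_le_sum fun k _ => mul_le_mul_of_nonneg_left (h _) (μ.weight_nonneg k)

lemma avg_add (μ : FinProb n A) (f g : A → ℝ) :
    μ.avg (fun x => f x + g x) = μ.avg f + μ.avg g := by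
  simp [avg, mul_add, Finset.sum_add_distrib]

lemma avg_neg (μ : FinProb n A) (f : A → ℝ) : μ.avg (fun x => -f x) = -μ.avg f := by
  simp [avg]

lemma avg_comm (μ : FinProb n A) (ν : FinProb m B) (h : A → B → ℝ) :
    μ.avg (fun x => ν.avg (h x)) = ν.avg (fun y => μ.avg fun x => h x y) := by
  simp only [avg, Finset.mul_sum]
  rw [Finset.sum_comm]
  exact Finset.sum_congr rfl fun _ _ => Finset.sum_congr rfl fun _ _ => by ring

/-- The probability obtained by relabelling finitely many weighted points by `Fin n`, the number
of points being at most `n`. -/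
lemma exists_of_fintype {ι : Type*} [Fintype ι] (w : ι → ℝ) (x : ι → A) (hw : ∀ i, 0 ≤ w i)
    (hs : ∑ i, w i = 1) (hn : Fintype.card ι ≤ n) :
    ∃ μ : FinProb n A, ∀ f, μ.avg f = ∑ i, w i * f (x i) := by
  classical
  have : Nonempty ι := by
    by_contra h
    rw [not_nonempty_iff] at h
    simp at hs
  obtain ⟨i₀⟩ := this
  let e : ι ↪ Fin n := (Fintype.equivFin ι).toEmbedding.trans (Fin.castLEEmb hn)
  have key : ∀ F : ι → ℝ, ∑ k, Function.extend e F 0 k = ∑ i, F i := by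
    intro F
    rw [← Finset.sum_subset (Finset.subset_univ (Finset.univ.map e)), Finset.sum_map]
    · exact Finset.sum_congr rfl fun i _ => e.injective.extend_apply _ _ _
    · intro k _ hk
      refine Function.extend_apply' _ _ _ ?_
      rintro ⟨i, rfl⟩
      simp at hk
  have h0 : ∀ F : ι → ℝ, (∀ i, 0 ≤ F i) → ∀ k, 0 ≤ Function.extend e F 0 k := by
    intro F hF k
    by_cases hk : ∃ i, e i = k
    · obtain ⟨i, rfl⟩ := hk
      rw [e.injective.extend_apply]; exact hF i
    · rw [Function.extend_apply' _ _ _ hk]; simp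
  -- Labels outside the range of `e` get weight `0`, so their point `x i₀` is arbitrary.
  refine ⟨⟨Function.extend e w 0, Function.extend e x fun _ => x i₀, h0 w hw, by rw [key, hs]⟩,
    fun f => ?_⟩
  rw [← key fun i => w i * f (x i)]
  refine Finset.sum_congr rfl fun k _ => ?_
  by_cases hk : ∃ i, e i = k
  · obtain ⟨i, rfl⟩ := hk
    simp [e.injective.extend_apply]
  · simp [Function.extend_apply' _ _ _ hk]

/-- Carathéodory's theorem: the means of the functions of a finite-dimensional space are realized
by a probability carried by a bounded number of points. -/
lemma exists_avg_eq (V : Submodule ℝ (A → ℝ)) [FiniteDimensional ℝ V] (μ : FinProb n A) :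
    ∃ ν : FinProb (Module.finrank ℝ V + 1) A, ∀ f ∈ V, ν.avg f = μ.avg f := by
  -- Averaging over `V` is a convex combination of evaluations in the dual of `V`. Carathéodory's
  -- affinely independent representation there uses at most `finrank V + 1` evaluations.
  let ev : A → Module.Dual ℝ V := fun x => (LinearMap.proj x).comp V.subtype
  have hmem : ∑ k, μ.weight k • ev (μ.point k) ∈ convexHull ℝ (range ev) :=
    (convex_convexHull ℝ _).sum_mem (fun k _ => μ.weight_nonneg k) μ.weight_sum
      fun k _ => subset_convexHull ℝ _ ⟨_, rfl⟩
  obtain ⟨ι, _, z, w, hz, hind, hw, hs, hsum⟩ := eq_pos_convex_span_of_mem_convexHull hmem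
  have hcard : Fintype.card ι ≤ Module.finrank ℝ V + 1 := by
    refine hind.card_le_finrank_succ.trans (Nat.succ_le_succ ?_)
    exact (Submodule.finrank_le _).trans Subspace.dual_finrank_eq.le
  choose x hx using fun i => hz ⟨i, rfl⟩
  obtain ⟨ν, hν⟩ := exists_of_fintype w x (fun i => (hw i).le) hs hcard
  refine ⟨ν, fun f hf => ?_⟩
  have := congrArg (fun φ : Module.Dual ℝ V => φ ⟨f, hf⟩) hsum
  simp only [LinearMap.sum_apply, LinearMap.smul_apply, ← hx, ev, smul_eq_mul] at this
  rw [hν]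
  exact this

end FinProb

/-! ### Mixed values and the minimax theorem for compact games -/

/-- `v` is the value of the game `h` played with mixed actions, the first player maximizing. -/
def IsMixedValue {A B : Type*} (h : A → B → ℝ) (v : ℝ) : Prop :=
  ∀ ε > 0, (∃ n, ∃ μ : FinProb n A, ∀ y, v - ε ≤ μ.avg fun x => h x y) ∧
    ∃ n, ∃ ν : FinProb n B, ∀ x, ν.avg (h x) ≤ v + ε

namespace IsMixedValue

variable {A B : Type*} {h h' : A → B → ℝ} {v v' : ℝ}

/-- Nearly optimal mixed actions, the maximizer's in `h` and the minimizer's in `h'`, are played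
against each other: the double average of `h` is almost at least `v`, that of `h'` almost at most
`v'`. Taking `c = 0` gives monotonicity, hence uniqueness, of the value. -/
lemma le_add (hv : IsMixedValue h v) (hv' : IsMixedValue h' v') {c : ℝ}
    (hc : ∀ x y, h x y ≤ h' x y + c) : v ≤ v' + c := by
  refine le_of_forall_pos_le_add fun ε hε => ?_
  obtain ⟨_, μ, hμ⟩ := (hv (ε / 2) (by positivity)).1
  obtain ⟨_, ν, hν⟩ := (hv' (ε / 2) (by positivity)).2
  have h1 := ν.avg_mono hμ
  have h2 := μ.avg_mono hν
  have h3 := ν.avg_mono fun y => μ.avg_mono fun x => hc x y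
  simp only [FinProb.avg_add, FinProb.avg_const] at h1 h2 h3
  rw [μ.avg_comm] at h2
  linarith

end IsMixedValue

/-- It suffices to find approximate values. -/
lemma exists_isMixedValue_of_approx {A B : Type*} {h : A → B → ℝ}
    (H : ∀ ε > 0, ∃ c : ℝ, (∃ n, ∃ μ : FinProb n A, ∀ y, c - ε ≤ μ.avg fun x => h x y) ∧
      ∃ n, ∃ ν : FinProb n B, ∀ x, ν.avg (h x) ≤ c + ε) : ∃ v, IsMixedValue h v := by
  -- The value will be the supremum of the levels the maximizer guarantees; `hS` is weak duality.
  let S : Set ℝ := {c | ∃ n, ∃ μ : FinProb n A, ∀ y, c ≤ μ.avg fun x => h x y}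
  have hS : ∀ c ∈ S, ∀ {d n} {ν : FinProb n B}, (∀ x, ν.avg (h x) ≤ d) → c ≤ d := by
    rintro c ⟨n, μ, hμ⟩ d m ν hν
    have h1 := ν.avg_mono hμ
    have h2 := μ.avg_mono hν
    rw [μ.avg_comm] at h2
    simp only [FinProb.avg_const] at h1 h2
    linarith
  have hbdd : BddAbove S := by
    obtain ⟨c, -, m, ν, hν⟩ := H 1 one_pos
    exact ⟨c + 1, fun d hd => hS d hd hν⟩
  refine ⟨sSup S, fun ε hε => ?_⟩
  obtain ⟨c, hμ, m, ν, hν⟩ := H (ε / 2) (by positivity)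
  have hmem : c - ε / 2 ∈ S := hμ
  refine ⟨?_, m, ν, fun x => ?_⟩
  · obtain ⟨n, μ, hμ⟩ := hμ
    refine ⟨n, μ, fun y => le_trans ?_ (hμ y)⟩
    have := csSup_le ⟨_, hmem⟩ fun d hd => hS d hd hν
    linarith
  · have := le_csSup hbdd hmem
    linarith [hν x]

/-- Von Neumann's minimax theorem. -/
lemma exists_finite_minimax {m n : ℕ} (hm : 0 < m) (hn : 0 < n) (M : Fin m → Fin n → ℝ) :
    ∃ c : ℝ, ∃ s ∈ stdSimplex ℝ (Fin m), ∃ t ∈ stdSimplex ℝ (Fin n),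
      (∀ j, c ≤ ∑ i, s i * M i j) ∧ ∀ i, ∑ j, t j * M i j ≤ c := by
  have : NeZero m := ⟨hm.ne'⟩
  have : NeZero n := ⟨hn.ne'⟩
  let f : (Fin n → ℝ) → (Fin m → ℝ) → ℝ := fun t s => ∑ i, ∑ j, s i * t j * M i j
  have hf1 : ∀ s, IsLinearMap ℝ fun t => f t s := fun s => by
    constructor
    · intro t t'
      simp [f, mul_add, add_mul, Finset.sum_add_distrib]
    · intro c t
      simp only [f, Pi.smul_apply, smul_eq_mul, Finset.mul_sum]
      exact Finset.sum_congr rfl fun _ _ => Finset.sum_congr rfl fun _ _ => by ring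
  have hf2 : ∀ t, IsLinearMap ℝ fun s => f t s := fun t => by
    constructor
    · intro s s'
      simp [f, add_mul, Finset.sum_add_distrib]
    · intro c s
      simp only [f, Pi.smul_apply, smul_eq_mul, Finset.mul_sum]
      exact Finset.sum_congr rfl fun _ _ => Finset.sum_congr rfl fun _ _ => by ring
  obtain ⟨t, ht, s, hs, hsad⟩ := Sion.exists_isSaddlePointOn
    (X := stdSimplex ℝ (Fin n)) (Y := stdSimplex ℝ (Fin m)) (f := f)
    ⟨_, single_mem_stdSimplex ℝ 0⟩ (convex_stdSimplex ℝ _) (isCompact_stdSimplex ℝ _)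
    (fun s _ => Continuous.lowerSemicontinuous (by fun_prop) |>.lowerSemicontinuousOn _)
    (fun s _ => ((hf1 s).mk' _ |>.convexOn (convex_stdSimplex ℝ _)).quasiconvexOn)
    (convex_stdSimplex ℝ _) ⟨_, single_mem_stdSimplex ℝ 0⟩ (isCompact_stdSimplex ℝ _)
    (fun t _ => Continuous.upperSemicontinuous (by fun_prop) |>.upperSemicontinuousOn _)
    (fun t _ => ((hf2 t).mk' _ |>.concaveOn (convex_stdSimplex ℝ _)).quasiconcaveOn)
  refine ⟨f t s, s, hs, t, ht, fun j => ?_, fun i => ?_⟩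
  · refine (hsad _ (single_mem_stdSimplex ℝ j) s hs).trans' (hsad t ht s hs) |>.trans (le_of_eq ?_)
    simp [f, Pi.single_apply]
  · refine le_trans (le_of_eq ?_) (hsad t ht _ (single_mem_stdSimplex ℝ i))
    simp [f, Pi.single_apply, ite_mul]

/-- Compact games with continuous payoff have a value in mixed actions. -/
theorem exists_isMixedValue {A B : Type*} [PseudoMetricSpace A] [PseudoMetricSpace B]
    [CompactSpace A] [CompactSpace B] [Nonempty A] [Nonempty B] {h : A → B → ℝ}
    (hh : Continuous fun a : A × B => h a.1 a.2) : ∃ v, IsMixedValue h v := by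
  refine exists_isMixedValue_of_approx fun ε hε => ?_
  obtain ⟨δ, hδ, H⟩ := Metric.uniformContinuous_iff.1
    (CompactSpace.uniformContinuous_of_continuous hh) ε hε
  obtain ⟨s, hs, hsA⟩ := Metric.totallyBounded_iff.1 (isCompact_univ (X := A)).totallyBounded δ hδ
  obtain ⟨t, ht, htB⟩ := Metric.totallyBounded_iff.1 (isCompact_univ (X := B)).totallyBounded δ hδ
  obtain ⟨m, a, -, rfl⟩ := hs.fin_param
  obtain ⟨n, b, -, rfl⟩ := ht.fin_param
  have hA : ∀ x, ∃ i, dist x (a i) < δ := fun x => by simpa using hsA (mem_univ x)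
  have hB : ∀ y, ∃ j, dist y (b j) < δ := fun y => by simpa using htB (mem_univ y)
  -- The matrix game on the two `δ`-nets is solved exactly; replacing an opponent's action by a net
  -- point costs less than `ε`.
  obtain ⟨c, s, hs, t, ht, h1, h2⟩ := exists_finite_minimax
    (hA (Classical.arbitrary A)).choose.pos (hB (Classical.arbitrary B)).choose.pos
    fun i j => h (a i) (b j)
  have hdist : ∀ {x x' y y'}, dist x x' < δ → dist y y' < δ → |h x y - h x' y'| < ε :=
    fun hx hy => H (a := (_, _)) (b := (_, _)) (max_lt hx hy)
  let μ : FinProb m A := ⟨s, a, hs.1, hs.2⟩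
  let ν : FinProb n B := ⟨t, b, ht.1, ht.2⟩
  refine ⟨c, ⟨m, μ, fun y => ?_⟩, n, ν, fun x => ?_⟩
  · obtain ⟨j, hj⟩ := hB y
    have := μ.avg_mono (f := fun x => h x (b j)) (g := fun x => h x y + ε) fun x => by
      have := abs_lt.1 (hdist (x := x) (x' := x) (by simpa) hj)
      linarith
    rw [FinProb.avg_add, FinProb.avg_const] at this
    have h3 : c ≤ μ.avg fun x => h x (b j) := h1 j
    linarith
  · obtain ⟨i, hi⟩ := hA x
    have := ν.avg_mono (f := h x) (g := fun y => h (a i) y + ε) fun y => by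
      have := abs_lt.1 (hdist (y := y) (y' := y) hi (by simpa))
      linarith
    rw [FinProb.avg_add, FinProb.avg_const] at this
    have h3 : (ν.avg fun y => h (a i) y) ≤ c := h2 i
    linarith

/-! ### First-order calculus of definable predicates and functions -/

namespace OMinStructure

lemma append_eq_append_iff {α : Type*} {m n : ℕ} {a c : Fin m → α} {b d : Fin n → α} :
    Fin.append a b = Fin.append c d ↔ a = c ∧ b = d := by
  refine ⟨fun h => ⟨funext fun i => ?_, funext fun i => ?_⟩, fun ⟨h, h'⟩ => h ▸ h' ▸ rfl⟩
  · simpa using congrFun h (Fin.castAdd n i)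
  · simpa using congrFun h (Fin.natAdd m i)

variable (O : OMinStructure)

lemma inter_mem {p : ℕ} {A B : Set (Fin p → ℝ)} (hA : A ∈ O.sets p) (hB : B ∈ O.sets p) :
    A ∩ B ∈ O.sets p := by
  rw [← compl_compl (A ∩ B), compl_inter]
  exact O.compl_mem _ _ (O.union_mem _ _ (O.compl_mem _ _ hA) _ (O.compl_mem _ _ hB))

lemma biInter_mem {p : ℕ} {ι : Type*} (s : Finset ι) {A : ι → Set (Fin p → ℝ)}
    (hA : ∀ i, A i ∈ O.sets p) : ⋂ i ∈ s, A i ∈ O.sets p := by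
  classical
  induction s using Finset.induction with
  | empty => simpa using O.compl_mem _ _ (O.empty_mem p)
  | insert i s _ ih =>
    rw [Finset.set_biInter_insert]
    exact O.inter_mem (hA i) ih

lemma prod_univ_pow_mem {n : ℕ} {A : Set (Fin n → ℝ)} (hA : A ∈ O.sets n) :
    ∀ {m N : ℕ} (h : m + n = N),
      {z : Fin N → ℝ | (fun i : Fin n => z ⟨m + i, by omega⟩) ∈ A} ∈ O.sets N
  | 0, N, h => by
    obtain rfl : n = N := by omega
    convert hA using 1
    ext z
    exact iff_of_eq (congrArg (· ∈ A) (funext fun i => congrArg z (Fin.ext (Nat.zero_add _))))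
  | m + 1, N, h => by
    obtain ⟨N, rfl⟩ : ∃ k, N = k + 1 := ⟨m + n, by omega⟩
    have := O.univ_prod_mem _ _ (prod_univ_pow_mem hA (m := m) (N := N) (by omega))
    convert this using 1
    ext z
    refine iff_of_eq (congrArg (· ∈ A) (funext fun i => congrArg z (Fin.ext ?_)))
    simp; omega

lemma image_castAdd_mem {m : ℕ} : ∀ {n : ℕ} {A : Set (Fin (m + n) → ℝ)}, A ∈ O.sets (m + n) →
    (fun z : Fin (m + n) → ℝ => z ∘ Fin.castAdd n) '' A ∈ O.sets m
  | 0, A, hA => by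
    exact (image_id A).symm ▸ hA
  | n + 1, A, hA => by
    have := image_castAdd_mem (O.proj_mem _ _ hA)
    rwa [image_image] at this

/-- The map `f` may repeat or omit coordinates. The axioms only allow adding and projecting
coordinates, so `n` new ones are appended, tied to the old ones by the algebraic equations `w
(natAdd m i) = w (castAdd n (f i))`, and projected away. -/
lemma preimage_comp_mem {m n : ℕ} {A : Set (Fin n → ℝ)} (hA : A ∈ O.sets n)
    (f : Fin n → Fin m) : {z : Fin m → ℝ | z ∘ f ∈ A} ∈ O.sets m := by
  have h1 : {w : Fin (m + n) → ℝ | w ∘ Fin.natAdd m ∈ A} ∈ O.sets (m + n) :=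
    O.prod_univ_pow_mem hA rfl
  have h2 : ⋂ i ∈ (Finset.univ : Finset (Fin n)),
      {w : Fin (m + n) → ℝ | w (Fin.natAdd m i) = w (Fin.castAdd n (f i))} ∈ O.sets (m + n) := by
    refine O.biInter_mem _ fun i => ?_
    have := O.algebraic_mem (m + n)
      (MvPolynomial.X (Fin.natAdd m i) - MvPolynomial.X (Fin.castAdd n (f i)))
    simpa [sub_eq_zero] using this
  convert O.image_castAdd_mem (O.inter_mem h1 h2) using 1
  ext z
  constructor
  · intro hz
    refine ⟨Fin.append z (z ∘ f), ⟨?_, ?_⟩, ?_⟩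
    · have : Fin.append z (z ∘ f) ∘ Fin.natAdd m = z ∘ f := by ext; simp
      simpa [this] using hz
    · simp
    · ext; simp
  · rintro ⟨w, ⟨hw, hw'⟩, rfl⟩
    simp only [Finset.mem_univ, iInter_true, mem_iInter, mem_ofPred_eq] at hw hw'
    have : (w ∘ Fin.castAdd n) ∘ f = w ∘ Fin.natAdd m := funext fun i => (hw' i).symm
    simpa [this] using hw

/-- Definability of a predicate in variables indexed by a finite type. -/
def DefPred {ι : Type*} (P : (ι → ℝ) → Prop) : Prop :=
  ∃ (n : ℕ) (e : ι ≃ Fin n), {z : Fin n → ℝ | P (z ∘ e)} ∈ O.sets n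

/-- Definability of a function of variables indexed by a finite type. -/
def DefMap {ι : Type*} (F : (ι → ℝ) → ℝ) : Prop :=
  O.DefPred fun z : ι ⊕ Unit → ℝ => F (z ∘ Sum.inl) = z (Sum.inr ())

variable {O} {ι κ : Type*}

/-- Definability does not depend on the enumeration of the variables, since permuting coordinates
preserves definable sets. -/
lemma DefPred.mem_sets {n : ℕ} {P : (Fin n → ℝ) → Prop} (h : O.DefPred P) :
    {z | P z} ∈ O.sets n := by
  obtain ⟨k, e, h⟩ := h
  convert O.preimage_comp_mem h e.symm using 3 with z
  simp [Function.comp_assoc]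

lemma defPred_of_mem_sets {n : ℕ} {A : Set (Fin n → ℝ)} (h : A ∈ O.sets n) :
    O.DefPred fun z => z ∈ A :=
  ⟨n, Equiv.refl _, h⟩

namespace DefPred

lemma reindex [Finite κ] {P : (ι → ℝ) → Prop} (h : O.DefPred P) (f : ι → κ) :
    O.DefPred fun z : κ → ℝ => P (z ∘ f) := by
  obtain ⟨n, e, h⟩ := h
  obtain ⟨m, ⟨e'⟩⟩ := Finite.exists_equiv_fin κ
  refine ⟨m, e', ?_⟩
  convert O.preimage_comp_mem h (e' ∘ f ∘ e.symm) using 1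
  ext z
  refine iff_of_eq (congrArg P ?_)
  ext; simp

lemma not {P : (ι → ℝ) → Prop} (h : O.DefPred P) : O.DefPred fun z => ¬ P z := by
  obtain ⟨n, e, h⟩ := h
  exact ⟨n, e, O.compl_mem _ _ h⟩

lemma and {P Q : (ι → ℝ) → Prop} (hP : O.DefPred P) (hQ : O.DefPred Q) :
    O.DefPred fun z => P z ∧ Q z := by
  obtain ⟨n, e, h⟩ := hP
  have : Finite ι := .of_equiv _ e.symm
  have hQ' : {z : Fin n → ℝ | Q (z ∘ e)} ∈ O.sets n := (hQ.reindex e).mem_sets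
  exact ⟨n, e, O.inter_mem h hQ'⟩

lemma or {P Q : (ι → ℝ) → Prop} (hP : O.DefPred P) (hQ : O.DefPred Q) :
    O.DefPred fun z => P z ∨ Q z := by
  simpa only [not_and_or, not_not] using (hP.not.and hQ.not).not

lemma imp {P Q : (ι → ℝ) → Prop} (hP : O.DefPred P) (hQ : O.DefPred Q) :
    O.DefPred fun z => P z → Q z := by
  simpa only [imp_iff_not_or] using hP.not.or hQ

lemma ex [Finite ι] [Finite κ] {P : (ι → ℝ) → (κ → ℝ) → Prop}
    (h : O.DefPred fun z : ι ⊕ κ → ℝ => P (z ∘ Sum.inl) (z ∘ Sum.inr)) :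
    O.DefPred fun x => ∃ y, P x y := by
  obtain ⟨m, ⟨e⟩⟩ := Finite.exists_equiv_fin ι
  obtain ⟨n, ⟨e'⟩⟩ := Finite.exists_equiv_fin κ
  refine ⟨m, e, ?_⟩
  have h1 := O.image_castAdd_mem
    (h.reindex (Sum.elim (Fin.castAdd n ∘ e) (Fin.natAdd m ∘ e'))).mem_sets
  convert h1 using 1
  ext x
  constructor
  · rintro ⟨y, hy⟩
    refine ⟨Fin.append x (y ∘ e'.symm), ?_, ?_⟩
    · convert hy
      refine iff_of_eq (congrArg₂ P ?_ ?_) <;> · ext; simp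
    · ext; simp
  · rintro ⟨z, hz, rfl⟩
    exact ⟨_, hz⟩

lemma all [Finite ι] [Finite κ] {P : (ι → ℝ) → (κ → ℝ) → Prop}
    (h : O.DefPred fun z : ι ⊕ κ → ℝ => P (z ∘ Sum.inl) (z ∘ Sum.inr)) :
    O.DefPred fun x => ∀ y, P x y := by
  simpa only [not_exists, not_not] using (ex (P := fun x y => ¬ P x y) h.not).not

lemma forall_finite [Finite ι] [Finite κ] {P : κ → (ι → ℝ) → Prop} (h : ∀ k, O.DefPred (P k)) :
    O.DefPred fun z => ∀ k, P k z := by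
  obtain ⟨n, ⟨e⟩⟩ := Finite.exists_equiv_fin ι
  cases nonempty_fintype κ
  refine ⟨n, e, ?_⟩
  convert O.biInter_mem Finset.univ fun k => ((h k).reindex e).mem_sets using 1
  ext; simp

end DefPred

namespace DefMap

lemma reindex [Finite κ] {F : (ι → ℝ) → ℝ} (h : O.DefMap F) (f : ι → κ) :
    O.DefMap fun z : κ → ℝ => F (z ∘ f) :=
  DefPred.reindex h (Sum.map f id)

lemma poly [Finite ι] (P : MvPolynomial ι ℝ) : O.DefMap fun z => MvPolynomial.eval z P := by
  obtain ⟨n, ⟨e⟩⟩ := Finite.exists_equiv_fin (ι ⊕ Unit)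
  refine ⟨n, e, ?_⟩
  convert O.algebraic_mem n
    (MvPolynomial.rename (e ∘ Sum.inl) P - MvPolynomial.X (e (Sum.inr ()))) using 3 with z
  simp [MvPolynomial.eval_rename, sub_eq_zero, Function.comp_assoc]

lemma proj [Finite ι] (i : ι) : O.DefMap fun z => z i := by
  simpa using poly (O := O) (MvPolynomial.X i)

lemma const [Finite ι] (c : ℝ) : O.DefMap fun _ : ι → ℝ => c := by
  simpa using poly (O := O) (ι := ι) (MvPolynomial.C c)

end DefMap

/-- Only the graphs of the substituted functions are available, so their values are introduced as
existentially quantified variables. -/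
lemma DefPred.subst [Finite ι] [Finite κ] {P : (κ → ℝ) → Prop} (hP : O.DefPred P)
    {G : κ → (ι → ℝ) → ℝ} (hG : ∀ k, O.DefMap (G k)) :
    O.DefPred fun x => P fun k => G k x := by
  have : (fun x => P fun k => G k x) = fun x => ∃ y : κ → ℝ, (∀ k, G k x = y k) ∧ P y := by
    ext x
    refine ⟨fun h => ⟨_, fun _ => rfl, h⟩, ?_⟩
    rintro ⟨y, hy, h⟩
    rwa [show (fun k => G k x) = y from funext hy]
  rw [this]
  refine DefPred.ex (DefPred.and (DefPred.forall_finite fun k => ?_) (hP.reindex Sum.inr))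
  exact DefPred.reindex (hG k) (Sum.map id fun _ => k)

namespace DefMap

lemma comp [Finite ι] [Finite κ] {F : (κ → ℝ) → ℝ} (hF : O.DefMap F)
    {G : κ → (ι → ℝ) → ℝ} (hG : ∀ k, O.DefMap (G k)) :
    O.DefMap fun x => F fun k => G k x := by
  have := DefPred.subst (ι := ι ⊕ Unit) hF
    (G := Sum.elim (fun k z => G k (z ∘ Sum.inl)) fun _ z => z (Sum.inr ())) (by
      rintro (k | k)
      · exact (hG k).reindex Sum.inl
      · exact proj _)
  exact this

variable [Finite ι] {F G : (ι → ℝ) → ℝ}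

lemma add (hF : O.DefMap F) (hG : O.DefMap G) : O.DefMap fun z => F z + G z := by
  have h := poly (O := O) (MvPolynomial.X true + MvPolynomial.X false : MvPolynomial Bool ℝ)
  simp only [map_add, MvPolynomial.eval_X] at h
  exact h.comp (G := fun k x => cond k (F x) (G x)) (Bool.forall_bool.2 ⟨hG, hF⟩)

lemma mul (hF : O.DefMap F) (hG : O.DefMap G) : O.DefMap fun z => F z * G z := by
  have h := poly (O := O) (MvPolynomial.X true * MvPolynomial.X false : MvPolynomial Bool ℝ)
  simp only [map_mul, MvPolynomial.eval_X] at h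
  exact h.comp (G := fun k x => cond k (F x) (G x)) (Bool.forall_bool.2 ⟨hG, hF⟩)

lemma sub (hF : O.DefMap F) (hG : O.DefMap G) : O.DefMap fun z => F z - G z := by
  have h := poly (O := O) (MvPolynomial.X true - MvPolynomial.X false : MvPolynomial Bool ℝ)
  simp only [map_sub, MvPolynomial.eval_X] at h
  exact h.comp (G := fun k x => cond k (F x) (G x)) (Bool.forall_bool.2 ⟨hG, hF⟩)

lemma neg (hF : O.DefMap F) : O.DefMap fun z => -F z := by
  simpa using (const (O := O) 0).sub hF

lemma sum [Fintype κ] {F : κ → (ι → ℝ) → ℝ} (hF : ∀ k, O.DefMap (F k)) :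
    O.DefMap fun z => ∑ k, F k z := by
  simpa using comp (O := O) (poly (∑ k, MvPolynomial.X k)) hF

lemma eq (hF : O.DefMap F) (hG : O.DefMap G) : O.DefPred fun z => F z = G z := by
  have : O.DefPred fun z : Unit → ℝ => z () = 0 := by
    refine ⟨1, Equiv.ofUnique _ _, ?_⟩
    simpa using O.algebraic_mem 1 (MvPolynomial.X 0)
  simpa [sub_eq_zero] using this.subst (G := fun _ z => F z - G z) fun _ => hF.sub hG

lemma le (hF : O.DefMap F) (hG : O.DefMap G) : O.DefPred fun z => F z ≤ G z := by
  -- The order is recovered from the algebra: nonnegative reals are the squares.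
  have h0 : O.DefPred fun z : ι → ℝ => ∃ y : Unit → ℝ, G z - F z = y () * y () :=
    DefPred.ex (((hG.sub hF).reindex Sum.inl).eq ((proj _).mul (proj _)))
  convert h0 using 2 with z
  constructor
  · intro h
    exact ⟨fun _ => √(G z - F z), (Real.mul_self_sqrt (sub_nonneg.2 h)).symm⟩
  · rintro ⟨y, hy⟩
    nlinarith [mul_self_nonneg (y ())]

lemma lt (hF : O.DefMap F) (hG : O.DefMap G) : O.DefPred fun z => F z < G z := by
  simpa only [not_le] using (hG.le hF).not

end DefMap

/-- A definable function on `X × Y`, extended by zero, is definable. -/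
lemma DefinableFun.defMap {p q : ℕ} {X : Set (Fin p → ℝ)} {Y : Set (Fin q → ℝ)}
    (hX : X ∈ O.sets p) (hY : Y ∈ O.sets q) {f : X → Y → ℝ} (hf : O.DefinableFun f)
    {F : (Fin p ⊕ Fin q → ℝ) → ℝ} (hF : ∀ (x : X) (y : Y), F (Sum.elim x y) = f x y)
    (hF' : ∀ z, ¬ (z ∘ Sum.inl ∈ X ∧ z ∘ Sum.inr ∈ Y) → F z = 0) : O.DefMap F := by
  -- The graph of `F` is the graph of `f` (`h1`) together with the zero function off `X × Y` (`h2`).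
  have h1 := (defPred_of_mem_sets hf).reindex
    (κ := (Fin p ⊕ Fin q) ⊕ Unit)
    (Fin.append (Fin.append (Sum.inl ∘ Sum.inl) (Sum.inl ∘ Sum.inr)) ![Sum.inr ()])
  have h2 : O.DefPred fun z : (Fin p ⊕ Fin q) ⊕ Unit → ℝ =>
      ¬ (z ∘ Sum.inl ∘ Sum.inl ∈ X ∧ z ∘ Sum.inl ∘ Sum.inr ∈ Y) ∧ z (Sum.inr ()) = 0 :=
    (((defPred_of_mem_sets hX).reindex _).and ((defPred_of_mem_sets hY).reindex _)).not.and
      ((DefMap.proj _).eq (DefMap.const 0))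
  unfold DefMap
  convert h1.or h2 using 2 with z
  have hz : F (z ∘ Sum.inl) = F (Sum.elim (z ∘ Sum.inl ∘ Sum.inl) (z ∘ Sum.inl ∘ Sum.inr)) :=
    congrArg F (Sum.elim_comp_inl_inr (z ∘ Sum.inl)).symm
  have happ : z ∘ Fin.append (Fin.append (Sum.inl ∘ Sum.inl) (Sum.inl ∘ Sum.inr))
      ![Sum.inr ()] = Fin.append (Fin.append (z ∘ Sum.inl ∘ Sum.inl) (z ∘ Sum.inl ∘ Sum.inr))
        ![z (Sum.inr ())] := by
    ext i
    refine Fin.addCases (fun i => Fin.addCases (fun i => ?_) (fun i => ?_) i) (fun i => ?_) i <;>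
      simp
  rw [happ]
  by_cases h : z ∘ Sum.inl ∘ Sum.inl ∈ X ∧ z ∘ Sum.inl ∘ Sum.inr ∈ Y
  · rw [or_iff_left (fun h' => h'.1 h)]
    constructor
    · intro hf
      refine ⟨⟨_, h.1⟩, ⟨_, h.2⟩, ?_⟩
      rw [← hF, ← hf, hz]
    · rintro ⟨x, y, hxy⟩
      rw [append_eq_append_iff, append_eq_append_iff] at hxy
      rw [hz, hxy.1.1, hxy.1.2, hF]
      exact (congrFun hxy.2 0).symm
  · rw [hF' _ h]
    simp only [h, not_false_eq_true, true_and, mem_ofPred_eq]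
    refine ⟨fun h0 => .inr h0.symm, ?_⟩
    rintro (⟨x, y, hxy⟩ | h0)
    · rw [append_eq_append_iff, append_eq_append_iff] at hxy
      exact absurd ⟨hxy.1.1 ▸ x.2, hxy.1.2 ▸ y.2⟩ h
    · exact h0.symm

end OMinStructure

/-! ### Integration of bounded measurable functions -/

lemma integral_kernel_comp_measure {α β : Type*} {mα : MeasurableSpace α} {mβ : MeasurableSpace β}
    {κ : Kernel α β} {μ : Measure α} {f : β → ℝ} (hf : Integrable f (κ ∘ₘ μ)) :
    ∫ y, f y ∂(κ ∘ₘ μ) = ∫ x, ∫ y, f y ∂(κ x) ∂μ := by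
  rw [Measure.comp_eq_comp_const_apply] at hf ⊢
  rw [Kernel.integral_comp hf]
  simp

/-- A bounded measurable function. -/
structure BddMeasurable {α : Type*} [MeasurableSpace α] (f : α → ℝ) : Prop where
  measurable : Measurable f
  bdd : ∃ C, ∀ x, |f x| ≤ C

namespace BddMeasurable

variable {α β : Type*} [MeasurableSpace α] [MeasurableSpace β] {f g : α → ℝ}

lemma integrable (hf : BddMeasurable f) (μ : Measure α) [IsFiniteMeasure μ] : Integrable f μ := by
  obtain ⟨C, hC⟩ := hf.bdd
  exact .of_bound hf.measurable.aestronglyMeasurable C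
    (.of_forall fun x => hC x)

lemma comp (hf : BddMeasurable f) {u : β → α} (hu : Measurable u) :
    BddMeasurable fun x => f (u x) :=
  ⟨hf.measurable.comp hu, hf.bdd.imp fun _ h _ => h _⟩

lemma add (hf : BddMeasurable f) (hg : BddMeasurable g) : BddMeasurable fun x => f x + g x := by
  obtain ⟨C, hC⟩ := hf.bdd
  obtain ⟨D, hD⟩ := hg.bdd
  exact ⟨hf.measurable.add hg.measurable, C + D,
    fun x => (abs_add_le _ _).trans (add_le_add (hC x) (hD x))⟩

lemma const_mul (c : ℝ) (hf : BddMeasurable f) : BddMeasurable fun x => c * f x := by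
  obtain ⟨C, hC⟩ := hf.bdd
  exact ⟨hf.measurable.const_mul c, |c| * C,
    fun x => by rw [abs_mul]; exact mul_le_mul_of_nonneg_left (hC x) (abs_nonneg c)⟩

lemma integral_kernel (hf : BddMeasurable f) (κ : Kernel β α) [IsMarkovKernel κ] :
    BddMeasurable fun x => ∫ y, f y ∂κ x := by
  obtain ⟨C, hC⟩ := hf.bdd
  refine ⟨hf.measurable.stronglyMeasurable.integral_kernel.measurable, C, fun x => ?_⟩
  simpa using norm_integral_le_of_norm_le_const (μ := κ x) (f := f)
    (.of_forall fun y => hC y)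

lemma of_finite [Finite α] [MeasurableSingletonClass α] (f : α → ℝ) : BddMeasurable f := by
  obtain ⟨C, hC⟩ := (Set.finite_range fun x => |f x|).bddAbove
  exact ⟨measurable_of_finite f, C, fun x => hC ⟨x, rfl⟩⟩

end BddMeasurable

namespace FinProb

variable {n : ℕ} {A : Type*} [MeasurableSpace A]

/-- The measure carried by finitely many points. -/
noncomputable def toMeasure (μ : FinProb n A) : Measure A :=
  ∑ k, ENNReal.ofReal (μ.weight k) • Measure.dirac (μ.point k)

instance (μ : FinProb n A) : IsProbabilityMeasure μ.toMeasure where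
  measure_univ := by
    simp only [toMeasure, Measure.coe_finsetSum, Finset.sum_apply, Measure.smul_apply, smul_eq_mul,
      measure_univ, mul_one]
    rw [← ENNReal.ofReal_sum_of_nonneg fun k _ => μ.weight_nonneg k, μ.weight_sum,
      ENNReal.ofReal_one]

lemma integral_toMeasure (μ : FinProb n A) {f : A → ℝ} (hf : BddMeasurable f) :
    ∫ x, f x ∂μ.toMeasure = μ.avg f := by
  rw [toMeasure, integral_finsetSum_measure]
  · simp only [integral_smul_measure]
    refine Finset.sum_congr rfl fun k _ => ?_
    rw [integral_dirac' _ _ hf.measurable.stronglyMeasurable,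
      ENNReal.toReal_ofReal (μ.weight_nonneg k), smul_eq_mul]
  · exact fun k _ => (hf.integrable _).smul_measure ENNReal.ofReal_ne_top

end FinProb

/-! ### Laws of play and dynamic programming -/

namespace StochasticGame

variable {Ω : Type*} [Fintype Ω] {p q : ℕ}

section Basic

variable (G : StochasticGame Ω p q)

instance : CompactSpace G.X := isCompact_iff_compactSpace.1 G.isCompact_X
instance : CompactSpace G.Y := isCompact_iff_compactSpace.1 G.isCompact_Y

/-- The mean of a function of the next state. -/
def nextMean (f : Ω → ℝ) (ω : Ω) (x : G.X) (y : G.Y) : ℝ := ∑ ω', G.ρ ω x y ω' * f ω'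

lemma ρ_nonneg (ω : Ω) (x : G.X) (y : G.Y) (ω' : Ω) : 0 ≤ G.ρ ω x y ω' := (G.ρ ω x y).2.1 ω'

variable {G} in
lemma exists_bound {R : Ω → G.X → G.Y → ℝ}
    (hR : ∀ ω, Continuous fun a : G.X × G.Y => R ω a.1 a.2) :
    ∃ C, 0 ≤ C ∧ ∀ ω x y, |R ω x y| ≤ C := by
  have h : ∀ ω, ∃ C, ∀ a : G.X × G.Y, |R ω a.1 a.2| ≤ C := fun ω => by
    obtain ⟨C, hC⟩ := (isCompact_univ.image (hR ω).abs).bddAbove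
    exact ⟨C, fun a => hC ⟨a, mem_univ _, rfl⟩⟩
  choose C hC using h
  refine ⟨∑ ω, |C ω|, Finset.sum_nonneg fun _ _ => abs_nonneg _,
    fun ω x y => (hC ω (x, y)).trans ((le_abs_self _).trans ?_)⟩
  exact Finset.single_le_sum (f := fun ω => |C ω|) (fun _ _ => abs_nonneg _) (Finset.mem_univ ω)

end Basic

variable [MeasurableSpace Ω] [MeasurableSingletonClass Ω] (G : StochasticGame Ω p q)

lemma integral_transition (f : Ω → ℝ) (s : G.Stage) :
    ∫ ω', f ω' ∂G.transition s = G.nextMean f s.1 s.2.1 s.2.2 := by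
  change ∫ ω', f ω' ∂(∑ ω', ENNReal.ofReal (G.ρ s.1 s.2.1 s.2.2 ω') • Measure.dirac ω') = _
  rw [integral_finsetSum_measure]
  · simp only [integral_smul_measure, integral_dirac]
    refine Finset.sum_congr rfl fun k _ => ?_
    rw [ENNReal.toReal_ofReal (G.ρ_nonneg _ _ _ _), smul_eq_mul]
  · exact fun k _ => ((BddMeasurable.of_finite f).integrable _).smul_measure ENNReal.ofReal_ne_top

lemma bddMeasurable_nextMean (f : Ω → ℝ) :
    BddMeasurable fun s : G.Stage => G.nextMean f s.1 s.2.1 s.2.2 := by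
  simpa only [integral_transition] using (BddMeasurable.of_finite f).integral_kernel G.transition

lemma bddMeasurable_reward : BddMeasurable G.reward := by
  obtain ⟨C, -, hC⟩ := exists_bound G.continuous_g
  exact ⟨measurable_from_prod_countable_right fun ω => (G.continuous_g ω).measurable,
    C, fun s => hC s.1 s.2.1 s.2.2⟩

section Play

variable (σ : G.Strategy G.X) (τ : G.Strategy G.Y) (ω : Ω)

instance : IsProbabilityMeasure (G.playMeasure σ τ ω) := by
  unfold playMeasure; infer_instance

/-- The law of the history before stage `n`. -/
noncomputable def histLaw : (n : ℕ) → Measure (G.Hist n)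
  | 0 => Measure.dirac (Fin.elim0, ω)
  | n + 1 => G.histKernel n ∘ₘ (G.playMeasure σ τ ω).map (Preorder.frestrictLe n)

instance (n : ℕ) : IsProbabilityMeasure (G.histLaw σ τ ω n) := by
  cases n with
  | zero => unfold histLaw; infer_instance
  | succ n =>
    have : IsProbabilityMeasure ((G.playMeasure σ τ ω).map (Preorder.frestrictLe n)) :=
      Measure.isProbabilityMeasure_map (by fun_prop)
    unfold histLaw; infer_instance

/-- At stage `0` this is the initial law of the trajectory. Later, the joint law of the stages up to
`n` and stage `n + 1` is a composition-product with `nextStage`; its second marginal factors through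
the history because `nextStage` is the composite of `histKernel` and `stageKernel`. -/
lemma map_stage (n : ℕ) : (G.playMeasure σ τ ω).map (fun h => h n) =
    G.stageKernel σ τ n ∘ₘ G.histLaw σ τ ω n := by
  cases n with
  | zero =>
    have h : (G.playMeasure σ τ ω).map (Preorder.frestrictLe 0) =
        (G.stageKernel σ τ 0 (Fin.elim0, ω)).map
          (MeasurableEquiv.piUnique fun _ : Finset.Iic 0 => G.Stage).symm := by
      rw [playMeasure, Kernel.trajMeasure, Measure.map_comp _ _ (by fun_prop),
        Kernel.traj_map_frestrictLe, Kernel.partialTraj_self]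
      exact Measure.id_comp
    have h' := congrArg (Measure.map fun z => z ⟨0, Finset.mem_Iic.2 le_rfl⟩) h
    rw [Measure.map_map (by fun_prop) (by fun_prop),
      Measure.map_map (by fun_prop) (by fun_prop)] at h'
    rw [histLaw, Measure.dirac_bind (Kernel.measurable _)]
    refine h'.trans ?_
    convert Measure.map_id
    let e := MeasurableEquiv.piUnique fun _ : Finset.Iic 0 => G.Stage
    ext1 s
    change e.symm s _ = s
    rw [Subsingleton.elim (⟨0, Finset.mem_Iic.2 le_rfl⟩ : Finset.Iic 0) default]
    exact e.apply_symm_apply s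
  | succ n =>
    have h := Kernel.map_frestrictLe_trajMeasure_compProd_eq_map_trajMeasure
      (X := fun _ => G.Stage) (μ₀ := G.stageKernel σ τ 0 (Fin.elim0, ω)) (κ := G.nextStage σ τ)
      (a := n)
    have h' := congrArg Measure.snd h
    rw [Measure.snd_compProd, Measure.snd_map_prodMk (by fun_prop)] at h'
    rw [histLaw, Measure.comp_assoc]
    exact h'.symm

lemma integral_stage {f : G.Stage → ℝ} (hf : BddMeasurable f) (n : ℕ) :
    ∫ h, f (h n) ∂G.playMeasure σ τ ω =
      ∫ k, ∫ s, f s ∂(G.stageKernel σ τ n k) ∂(G.histLaw σ τ ω n) := by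
  rw [← integral_kernel_comp_measure (hf.integrable _), ← map_stage,
    integral_map (measurable_pi_apply n).aemeasurable hf.measurable.aestronglyMeasurable]

lemma integral_stageKernel_fst (f : Ω → ℝ) (n : ℕ) (k : G.Hist n) :
    ∫ s, f s.1 ∂(G.stageKernel σ τ n k) = f k.2 := by
  have hf : BddMeasurable fun s : G.Stage => f s.1 :=
    (BddMeasurable.of_finite f).comp measurable_fst
  have := hf.integrable (G.stageKernel σ τ n k)
  rw [stageKernel, Kernel.prod_apply] at this ⊢
  rw [integral_prod _ this]
  simp [Kernel.deterministic_apply]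

lemma integral_state (f : Ω → ℝ) (n : ℕ) :
    ∫ h, f (h n).1 ∂G.playMeasure σ τ ω = ∫ k, f k.2 ∂G.histLaw σ τ ω n := by
  rw [G.integral_stage σ τ ω (f := fun s => f s.1)
    ((BddMeasurable.of_finite f).comp measurable_fst)]
  simp only [integral_stageKernel_fst]

/-- The Markov property of the state: given the past stages, `histKernel` draws the new state from
`transition` alone. This is what lets the inequalities of `potential_le` telescope. -/
lemma integral_state_succ (f : Ω → ℝ) (n : ℕ) :
    ∫ h, f (h (n + 1)).1 ∂G.playMeasure σ τ ω =
      ∫ h, G.nextMean f (h n).1 (h n).2.1 (h n).2.2 ∂G.playMeasure σ τ ω := by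
  have : IsProbabilityMeasure ((G.playMeasure σ τ ω).map (Preorder.frestrictLe n)) :=
    Measure.isProbabilityMeasure_map (by fun_prop)
  have hf : BddMeasurable fun k : G.Hist (n + 1) => f k.2 :=
    (BddMeasurable.of_finite f).comp measurable_snd
  rw [integral_state, histLaw, integral_kernel_comp_measure (hf.integrable _)]
  rw [integral_map (by fun_prop) (hf.integral_kernel _).measurable.aestronglyMeasurable]
  congr 1 with h
  have := hf.integrable (G.histKernel n (Preorder.frestrictLe n h))
  rw [histKernel, Kernel.prod_apply] at this ⊢
  rw [integral_prod _ this]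
  simp [integral_transition, Kernel.comap_apply]

lemma integral_state_zero (f : Ω → ℝ) :
    ∫ h, f (h 0).1 ∂G.playMeasure σ τ ω = f ω := by
  rw [integral_state, histLaw, integral_dirac' _ _
    ((BddMeasurable.of_finite f).comp measurable_snd).measurable.stronglyMeasurable]

/-- Dynamic programming: potentials which at each stage are at most the expected reward plus the
expected potential at the next stage, up to an error. -/
lemma potential_le {R : G.Stage → ℝ} (hR : BddMeasurable R) (a e : ℕ → ℝ) (F : ℕ → Ω → ℝ) (n : ℕ)
    (H : ∀ i < n, ∀ k : G.Hist i, F i k.2 - e i ≤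
      ∫ s, (a i * R s + G.nextMean (F (i + 1)) s.1 s.2.1 s.2.2) ∂(G.stageKernel σ τ i k)) :
    F 0 ω - ∑ i ∈ Finset.range n, e i ≤
      ∑ i ∈ Finset.range n, a i * ∫ h, R (h i) ∂G.playMeasure σ τ ω +
        ∫ h, F n (h n).1 ∂G.playMeasure σ τ ω := by
  induction n with
  | zero => simp [integral_state_zero]
  | succ n ih =>
    have ih := ih fun i hi => H i (by omega)
    have hb := (hR.const_mul (a n)).add (G.bddMeasurable_nextMean (F (n + 1)))
    have h1 : ∫ h, F n (h n).1 ∂G.playMeasure σ τ ω - e n ≤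
        ∫ h, (a n * R (h n) + G.nextMean (F (n + 1)) (h n).1 (h n).2.1 (h n).2.2)
          ∂G.playMeasure σ τ ω := by
      rw [G.integral_stage σ τ ω hb, integral_state]
      have hF : BddMeasurable fun k : G.Hist n => F n k.2 :=
        (BddMeasurable.of_finite (F n)).comp measurable_snd
      calc _ = ∫ k, (F n k.2 - e n) ∂G.histLaw σ τ ω n := by
            rw [integral_sub (hF.integrable _) (integrable_const _)]; simp
        _ ≤ _ := integral_mono ((hF.integrable _).sub (integrable_const _))
            ((hb.integral_kernel _).integrable _) fun k => H n (by omega) k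
    -- The expected `nextMean` of `F (n + 1)` at stage `n` is the expected `F (n + 1)` at stage `n +
    -- 1`, so `h1` chains with the induction hypothesis.
    rw [integral_add, ← integral_state_succ, integral_const_mul] at h1
    · rw [Finset.sum_range_succ, Finset.sum_range_succ]
      linarith
    · exact ((hR.const_mul (a n)).comp (measurable_pi_apply n)).integrable _
    · exact ((G.bddMeasurable_nextMean (F (n + 1))).comp (measurable_pi_apply n)).integrable _

end Play

end StochasticGame

/-! ### Markov strategies and the values they guarantee -/

namespace FinProb

lemma avg_mul {n : ℕ} {A : Type*} (μ : FinProb n A) (c : ℝ) (f : A → ℝ) :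
    μ.avg (fun x => c * f x) = c * μ.avg f := by
  simp only [avg, Finset.mul_sum]
  exact Finset.sum_congr rfl fun _ _ => by ring

lemma bddMeasurable_avg {n : ℕ} {A B : Type*} [MeasurableSpace B] (μ : FinProb n A)
    {f : A → B → ℝ} (hf : ∀ x, BddMeasurable (f x)) :
    BddMeasurable fun y => μ.avg fun x => f x y := by
  choose C hC using fun x => (hf x).bdd
  refine ⟨Finset.measurable_sum _ fun k _ => (hf _).measurable.const_mul _,
    ∑ k, |μ.weight k| * C (μ.point k), fun y => (Finset.abs_sum_le_sum_abs _ _).trans ?_⟩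
  refine Finset.sum_le_sum fun k _ => ?_
  rw [abs_mul]
  exact mul_le_mul_of_nonneg_left (hC _ _) (abs_nonneg _)

end FinProb

namespace StochasticGame

lemma nextMean_mul {Ω : Type*} [Fintype Ω] {p q : ℕ} (G : StochasticGame Ω p q) (c : ℝ)
    (f : Ω → ℝ) (ω : Ω) (x : G.X) (y : G.Y) :
    G.nextMean (fun ω' => c * f ω') ω x y = c * G.nextMean f ω x y := by
  simp only [nextMean, Finset.mul_sum]
  exact Finset.sum_congr rfl fun _ _ => by ring

variable {Ω : Type*} [Fintype Ω] {p q : ℕ} [MeasurableSpace Ω] [MeasurableSingletonClass Ω]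
variable (G : StochasticGame Ω p q)

/-- The Markov strategy which at stage `n` in state `ω` plays the mixed action `m n ω`. -/
noncomputable def markovStrategy {A : Type*} [MeasurableSpace A]
    (m : ℕ → Ω → Σ n, FinProb n A) : G.Strategy A where
  toKernel n := (Kernel.ofFunOfCountable fun ω => (m n ω).2.toMeasure).comap Prod.snd measurable_snd
  isMarkov n := ⟨fun k => inferInstanceAs (IsProbabilityMeasure (m n k.2).2.toMeasure)⟩

lemma integral_stageKernel (σ : G.Strategy G.X) (τ : G.Strategy G.Y)
    {f : G.Stage → ℝ} (hf : BddMeasurable f) (n : ℕ) (k : G.Hist n) :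
    ∫ s, f s ∂(G.stageKernel σ τ n k) =
      ∫ a, f (k.2, a) ∂((σ.toKernel n k).prod (τ.toKernel n k)) := by
  have h := hf.integrable (G.stageKernel σ τ n k)
  rw [stageKernel, Kernel.prod_apply] at h ⊢
  rw [integral_prod _ h, Kernel.deterministic_apply, integral_dirac, Kernel.prod_apply]

lemma integral_stageKernel_markov_left (m : ℕ → Ω → Σ n, FinProb n G.X) (τ : G.Strategy G.Y)
    {f : G.Stage → ℝ} (hf : BddMeasurable f) (n : ℕ) (k : G.Hist n) :
    ∫ s, f s ∂(G.stageKernel (G.markovStrategy m) τ n k) =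
      ∫ y, (m n k.2).2.avg (fun x => f (k.2, x, y)) ∂(τ.toKernel n k) := by
  have hk : BddMeasurable fun a : G.X × G.Y => f (k.2, a) := hf.comp measurable_prodMk_left
  rw [integral_stageKernel _ _ _ hf, integral_prod_symm _ (hk.integrable _)]
  congr 1 with y
  exact FinProb.integral_toMeasure _ (hk.comp measurable_prodMk_right)

lemma integral_stageKernel_markov_right (σ : G.Strategy G.X) (m : ℕ → Ω → Σ n, FinProb n G.Y)
    {f : G.Stage → ℝ} (hf : BddMeasurable f) (n : ℕ) (k : G.Hist n) :
    ∫ s, f s ∂(G.stageKernel σ (G.markovStrategy m) n k) =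
      ∫ x, (m n k.2).2.avg (fun y => f (k.2, x, y)) ∂(σ.toKernel n k) := by
  have hk : BddMeasurable fun a : G.X × G.Y => f (k.2, a) := hf.comp measurable_prodMk_left
  rw [integral_stageKernel _ _ _ hf, integral_prod _ (hk.integrable _)]
  congr 1 with x
  exact FinProb.integral_toMeasure _ (hk.comp measurable_prodMk_left)

/-- What a Markov strategy of Player 1 guarantees. -/
lemma markov_left_guarantee (m : ℕ → Ω → Σ n, FinProb n G.X) (τ : G.Strategy G.Y) (ω₀ : Ω)
    (a e : ℕ → ℝ) (F : ℕ → Ω → ℝ) (n : ℕ)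
    (H : ∀ i < n, ∀ ω y, F i ω - e i ≤
      (m i ω).2.avg fun x => a i * G.g ω x y + G.nextMean (F (i + 1)) ω x y) :
    F 0 ω₀ - ∑ i ∈ Finset.range n, e i ≤
      ∑ i ∈ Finset.range n,
          a i * ∫ h, G.reward (h i) ∂G.playMeasure (G.markovStrategy m) τ ω₀ +
        ∫ h, F n (h n).1 ∂G.playMeasure (G.markovStrategy m) τ ω₀ := by
  refine G.potential_le _ τ ω₀ G.bddMeasurable_reward a e F n fun i hi k => ?_
  have hb := (G.bddMeasurable_reward.const_mul (a i)).add (G.bddMeasurable_nextMean (F (i + 1)))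
  rw [integral_stageKernel_markov_left _ _ _ hb]
  have hk : BddMeasurable fun y => (m i k.2).2.avg fun x =>
      a i * G.reward (k.2, x, y) + G.nextMean (F (i + 1)) k.2 x y :=
    FinProb.bddMeasurable_avg _ (f := fun x y =>
        a i * G.reward (k.2, x, y) + G.nextMean (F (i + 1)) k.2 x y) fun x =>
      hb.comp (u := fun y => (k.2, x, y)) (by fun_prop)
  -- The bound holds against every pure action, hence after averaging over whatever mixed action `τ`
  -- prescribes at this history.
  simpa using integral_mono (integrable_const _) (hk.integrable (τ.toKernel i k)) (H i hi k.2)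

/-- What a Markov strategy of Player 2 guarantees. -/
lemma markov_right_guarantee (σ : G.Strategy G.X) (m : ℕ → Ω → Σ n, FinProb n G.Y) (ω₀ : Ω)
    (a e : ℕ → ℝ) (F : ℕ → Ω → ℝ) (n : ℕ)
    (H : ∀ i < n, ∀ ω x,
      ((m i ω).2.avg fun y => a i * G.g ω x y + G.nextMean (F (i + 1)) ω x y) ≤ F i ω + e i) :
    ∑ i ∈ Finset.range n,
          a i * ∫ h, G.reward (h i) ∂G.playMeasure σ (G.markovStrategy m) ω₀ +
        ∫ h, F n (h n).1 ∂G.playMeasure σ (G.markovStrategy m) ω₀ ≤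
      F 0 ω₀ + ∑ i ∈ Finset.range n, e i := by
  -- The upper bound is the lower bound for the negated reward and the negated potentials.
  have key := G.potential_le σ (G.markovStrategy m) ω₀ (G.bddMeasurable_reward.const_mul (-1))
    a e (fun i ω => -F i ω) n fun i hi k => by
      have hb := ((G.bddMeasurable_reward.const_mul (-1)).const_mul (a i)).add
        (G.bddMeasurable_nextMean fun ω => -F (i + 1) ω)
      rw [integral_stageKernel_markov_right _ _ _ hb]
      have hk : BddMeasurable fun x => (m i k.2).2.avg fun y =>
          a i * (-1 * G.reward (k.2, x, y)) + G.nextMean (fun ω => -F (i + 1) ω) k.2 x y :=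
        FinProb.bddMeasurable_avg _ (f := fun y x =>
          a i * (-1 * G.reward (k.2, x, y)) + G.nextMean (fun ω => -F (i + 1) ω) k.2 x y) fun y =>
          hb.comp (u := fun x => (k.2, x, y)) (by fun_prop)
      refine le_trans ?_ (integral_mono (integrable_const (-F i k.2 - e i))
        (hk.integrable (σ.toKernel i k)) fun x => ?_)
      · simp
      · have h := H i hi k.2 x
        have h' : ((m i k.2).2.avg fun y =>
            a i * (-1 * G.reward (k.2, x, y)) + G.nextMean (fun ω => -F (i + 1) ω) k.2 x y) =
            -(m i k.2).2.avg fun y => a i * G.g k.2 x y + G.nextMean (F (i + 1)) k.2 x y := by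
          rw [← FinProb.avg_neg]
          congr 1 with y
          simp [nextMean, reward]
          ring
        linarith
  simp only [neg_mul, one_mul, integral_neg, mul_neg, Finset.sum_neg_distrib] at key
  linarith

section Values

variable {G}

/-- The `n`-stage value, from the recursive formula for the total payoff. -/
theorem isValue_payoffN {V : ℕ → Ω → ℝ} (h0 : ∀ ω, V 0 ω = 0)
    (hV : ∀ n ω, IsMixedValue (fun x y => G.g ω x y + G.nextMean (V n) ω x y) (V (n + 1) ω))
    {n : ℕ} (hn : 1 ≤ n) (ω : Ω) : IsValue (G.payoffN n ω) (V n ω / n) := by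
  intro ε hε
  have hn' : (0 : ℝ) < n := by exact_mod_cast hn
  have hint : ∀ (σ τ), G.payoffN n ω σ τ =
      1 / (n : ℝ) * ∑ i ∈ Finset.range n, ∫ h, G.reward (h i) ∂G.playMeasure σ τ ω := fun σ τ => by
    rw [payoffN, integral_finsetSum]
    exact fun i _ => (G.bddMeasurable_reward.comp (measurable_pi_apply i)).integrable _
  have hsub : ∀ {i}, i < n → n - i = n - (i + 1) + 1 := fun hi => by omega
  constructor
  · choose k μ hμ using fun k ω => (hV k ω ε hε).1
    -- At stage `i`, counted from `0`, the continuation lasts `n - (i + 1)` stages. The potential is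
    -- `V (n - i)`, which ends at `V 0 = 0`; the `n` errors `ε` average to `ε`.
    refine ⟨G.markovStrategy fun i ω => ⟨_, μ (n - (i + 1)) ω⟩, fun τ => ?_⟩
    have key := G.markov_left_guarantee (fun i ω => ⟨_, μ (n - (i + 1)) ω⟩) τ ω (fun _ => 1)
      (fun _ => ε) (fun i => V (n - i)) n fun i hi ω y => by
        simpa only [one_mul, hsub hi] using hμ (n - (i + 1)) ω y
    simp only [Nat.sub_zero, Finset.sum_const, Finset.card_range, nsmul_eq_mul, one_mul,
      Nat.sub_self, h0, integral_zero, add_zero] at key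
    rw [hint, div_sub' hn'.ne', one_div, ← div_eq_inv_mul]
    exact div_le_div_of_nonneg_right key hn'.le
  · choose k ν hν using fun k ω => (hV k ω ε hε).2
    refine ⟨G.markovStrategy fun i ω => ⟨_, ν (n - (i + 1)) ω⟩, fun σ => ?_⟩
    have key := G.markov_right_guarantee σ (fun i ω => ⟨_, ν (n - (i + 1)) ω⟩) ω (fun _ => 1)
      (fun _ => ε) (fun i => V (n - i)) n fun i hi ω x => by
        simpa only [one_mul, hsub hi] using hν (n - (i + 1)) ω x
    simp only [Nat.sub_zero, Finset.sum_const, Finset.card_range, nsmul_eq_mul, one_mul,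
      Nat.sub_self, h0, integral_zero, add_zero] at key
    rw [hint, div_add' _ _ _ hn'.ne', one_div, ← div_eq_inv_mul, mul_comm ε]
    exact div_le_div_of_nonneg_right key hn'.le

/-- The discounted value, from the fixed point equation. -/
theorem isValue_payoffDisc {lam : ℝ} (h0 : 0 < lam) (h1 : lam ≤ 1) {w : Ω → ℝ}
    (hw : ∀ ω, IsMixedValue
      (fun x y => lam * G.g ω x y + (1 - lam) * G.nextMean w ω x y) (w ω)) (ω : Ω) :
    IsValue (G.payoffDisc lam ω) (w ω) := by
  have hlim : Tendsto (fun n : ℕ => (1 - lam) ^ n) atTop (𝓝 0) :=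
    tendsto_pow_atTop_nhds_zero_of_lt_one (by linarith) (by linarith)
  -- The truncated discounted sum plus the remaining potential tends to the discounted payoff, so a
  -- bound valid for every horizon passes to the limit.
  have hsum : ∀ σ τ, Tendsto (fun n => ∑ i ∈ Finset.range n, (lam * (1 - lam) ^ i) *
        ∫ h, G.reward (h i) ∂G.playMeasure σ τ ω + ∫ h, (1 - lam) ^ n * w (h n).1
          ∂G.playMeasure σ τ ω) atTop (𝓝 (G.payoffDisc lam ω σ τ)) := by
    intro σ τ
    obtain ⟨C, hC⟩ := G.bddMeasurable_reward.bdd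
    obtain ⟨W, hW⟩ := (BddMeasurable.of_finite w).bdd
    have hi : ∀ i, BddMeasurable fun h : ℕ → G.Stage => lam * (1 - lam) ^ i * G.reward (h i) :=
      fun i => (G.bddMeasurable_reward.comp (measurable_pi_apply i)).const_mul _
    have hs : Summable fun i : ℕ => lam * (1 - lam) ^ i * C :=
      ((summable_geometric_of_lt_one (by linarith) (by linarith)).mul_left lam).mul_right C
    have hS := hasSum_integral_of_summable_integral_norm
      (fun i => (hi i).integrable (G.playMeasure σ τ ω)) (Summable.of_nonneg_of_le
        (fun i => integral_nonneg fun _ => norm_nonneg _) (fun i => ?_) hs)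
    · have hT : Tendsto (fun n => ∫ h, (1 - lam) ^ n * w (h n).1 ∂G.playMeasure σ τ ω) atTop
          (𝓝 0) := by
        refine squeeze_zero_norm (fun n => ?_) (by simpa using hlim.mul_const W)
        refine (norm_integral_le_of_norm_le_const (C := (1 - lam) ^ n * W)
          (.of_forall fun h => ?_)).trans (by simp)
        rw [norm_mul, Real.norm_of_nonneg (pow_nonneg (by linarith) n)]
        exact mul_le_mul_of_nonneg_left (hW _) (pow_nonneg (by linarith) n)
      have := hS.tendsto_sum_nat.add hT
      simp only [integral_const_mul, mul_assoc, tsum_mul_left, add_zero] at this ⊢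
      rwa [payoffDisc, integral_const_mul]
    · have hnn : 0 ≤ lam * (1 - lam) ^ i := mul_nonneg h0.le (pow_nonneg (by linarith) i)
      refine (integral_mono ((hi i).integrable _).norm (integrable_const (lam * (1 - lam) ^ i * C))
        fun h => ?_).trans (by simp)
      change ‖_ * _‖ ≤ _
      rw [norm_mul, Real.norm_of_nonneg hnn]
      exact mul_le_mul_of_nonneg_left (hC _) hnn
  -- An error `lam * ε` at each stage, discounted, adds up to at most `ε`.
  have hgeom : ∀ ε n, ∑ i ∈ Finset.range n, (1 - lam) ^ i * (lam * ε) = (1 - (1 - lam) ^ n) * ε :=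
    fun ε n => by
      rw [← geom_sum_mul_neg (1 - lam) n, ← Finset.sum_mul]
      ring
  have hmul : ∀ (i : ℕ) (ω x y), lam * (1 - lam) ^ i * G.g ω x y +
      G.nextMean (fun ω' => (1 - lam) ^ (i + 1) * w ω') ω x y =
        (1 - lam) ^ i * (lam * G.g ω x y + (1 - lam) * G.nextMean w ω x y) := fun i ω x y => by
    rw [G.nextMean_mul]
    ring
  intro ε hε
  constructor
  · choose k μ hμ using fun ω => (hw ω (lam * ε) (by positivity)).1
    refine ⟨G.markovStrategy fun i ω => ⟨_, μ ω⟩, fun τ => ge_of_tendsto' (hsum _ τ) fun n => ?_⟩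
    have key := G.markov_left_guarantee (fun i ω => ⟨_, μ ω⟩) τ ω
      (fun i => lam * (1 - lam) ^ i) (fun i => (1 - lam) ^ i * (lam * ε))
      (fun i ω => (1 - lam) ^ i * w ω) n fun i hi ω y => by
        simp only [hmul, FinProb.avg_mul, ← mul_sub]
        exact mul_le_mul_of_nonneg_left (hμ ω y) (pow_nonneg (by linarith) i)
    rw [hgeom] at key
    have := mul_nonneg (pow_nonneg (sub_nonneg.2 h1) n) hε.le
    simp only [pow_zero, one_mul] at key
    linarith
  · choose k ν hν using fun ω => (hw ω (lam * ε) (by positivity)).2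
    refine ⟨G.markovStrategy fun i ω => ⟨_, ν ω⟩, fun σ => le_of_tendsto' (hsum σ _) fun n => ?_⟩
    have key := G.markov_right_guarantee σ (fun i ω => ⟨_, ν ω⟩) ω
      (fun i => lam * (1 - lam) ^ i) (fun i => (1 - lam) ^ i * (lam * ε))
      (fun i ω => (1 - lam) ^ i * w ω) n fun i hi ω x => by
        simp only [hmul, FinProb.avg_mul, ← mul_add]
        exact mul_le_mul_of_nonneg_left (hν ω x) (pow_nonneg (by linarith) i)
    rw [hgeom] at key
    have := mul_nonneg (pow_nonneg (sub_nonneg.2 h1) n) hε.le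
    simp only [pow_zero, one_mul] at key
    linarith

end Values

end StochasticGame

/-! ### Shapley's equations and comparison of finite-horizon with discounted values -/

namespace IsMixedValue

variable {A B : Type*} {h h' : A → B → ℝ} {v v' : ℝ}

lemma abs_sub_le (hv : IsMixedValue h v) (hv' : IsMixedValue h' v') {c : ℝ}
    (hc : ∀ x y, |h x y - h' x y| ≤ c) : |v - v'| ≤ c := by
  have h1 := hv.le_add hv' (c := c) fun x y => by linarith [(abs_le.1 (hc x y)).2]
  have h2 := hv'.le_add hv (c := c) fun x y => by linarith [(abs_le.1 (hc x y)).1]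
  exact abs_le.2 ⟨by linarith, by linarith⟩

lemma const_mul (hv : IsMixedValue h v) {c : ℝ} (hc : 0 < c) :
    IsMixedValue (fun x y => c * h x y) (c * v) := by
  intro ε hε
  obtain ⟨⟨n, μ, hμ⟩, m, ν, hν⟩ := hv (ε / c) (by positivity)
  refine ⟨⟨n, μ, fun y => ?_⟩, m, ν, fun x => ?_⟩
  · rw [FinProb.avg_mul]
    calc c * v - ε = c * (v - ε / c) := by field_simp
      _ ≤ _ := mul_le_mul_of_nonneg_left (hμ y) hc.le
  · rw [FinProb.avg_mul]
    calc _ ≤ c * (v + ε / c) := mul_le_mul_of_nonneg_left (hν x) hc.le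
      _ = c * v + ε := by field_simp

lemma zero [Nonempty A] [Nonempty B] : IsMixedValue (fun (_ : A) (_ : B) => (0 : ℝ)) 0 := by
  intro ε hε
  refine ⟨⟨1, ⟨fun _ => 1, fun _ => Classical.arbitrary A, by simp, by simp⟩, fun y => ?_⟩,
    1, ⟨fun _ => 1, fun _ => Classical.arbitrary B, by simp, by simp⟩, fun x => ?_⟩ <;>
  · rw [FinProb.avg_const]; linarith

end IsMixedValue

/-- If the increments of `D` are dominated by `n (t n - t (n + 1))`, where `t` decreases to `0`,
then `D n / n` tends to `0`. -/
lemma tendsto_div_of_increment_le {D t : ℕ → ℝ} {N : ℕ} (hD : ∀ n, 0 ≤ D n) (ht : ∀ n, 0 ≤ t n)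
    (ht0 : Tendsto t atTop (𝓝 0)) (h : ∀ n ≥ N, D (n + 1) ≤ D n + n * (t n - t (n + 1))) :
    Tendsto (fun n => D n / n) atTop (𝓝 0) := by
  -- Summation by parts: `D n + n * t n` increases by at most `t (n + 1)` at each step, and the
  -- Cesàro means of `t` tend to `0`.
  have key : ∀ n ≥ N, D n + n * t n ≤ D N + N * t N + ∑ j ∈ Finset.range n, t (j + 1) := by
    intro n hn
    induction n, hn using Nat.le_induction with
    | base => linarith [Finset.sum_nonneg fun j (_ : j ∈ Finset.range N) => ht (j + 1)]
    | succ n hn ih =>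
      rw [Finset.sum_range_succ]
      push_cast
      linarith [h n hn]
  have h1 : Tendsto (fun n : ℕ => (D N + N * t N) / n +
      (n : ℝ)⁻¹ * ∑ j ∈ Finset.range n, t (j + 1)) atTop (𝓝 0) := by
    simpa using (tendsto_const_div_atTop_nhds_zero_nat (D N + N * t N)).add
      ((tendsto_add_atTop_iff_nat 1).2 ht0).cesaro
  refine squeeze_zero' (.of_forall fun n => by have := hD n; positivity) ?_ h1
  filter_upwards [eventually_ge_atTop N] with n hn
  rw [← div_eq_inv_mul, ← add_div]
  refine div_le_div_of_nonneg_right ?_ (Nat.cast_nonneg n)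
  linarith [key n hn, mul_nonneg (Nat.cast_nonneg (α := ℝ) n) (ht n)]

namespace StochasticGame

variable {Ω : Type*} [Fintype Ω] {p q : ℕ} (G : StochasticGame Ω p q)

lemma abs_nextMean_sub_le (f f' : Ω → ℝ) (ω : Ω) (x : G.X) (y : G.Y) :
    |G.nextMean f ω x y - G.nextMean f' ω x y| ≤ ‖f - f'‖ := by
  have h1 : ∑ ω', G.ρ ω x y ω' = 1 := (G.ρ ω x y).2.2
  rw [nextMean, nextMean, ← Finset.sum_sub_distrib]
  calc _ ≤ ∑ ω', G.ρ ω x y ω' * ‖f - f'‖ := (Finset.abs_sum_le_sum_abs _ _).trans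
        (Finset.sum_le_sum fun ω' _ => by
          rw [← mul_sub, abs_mul, abs_of_nonneg (G.ρ_nonneg ω x y ω')]
          exact mul_le_mul_of_nonneg_left (norm_le_pi_norm (f - f') ω')
            (G.ρ_nonneg ω x y ω'))
    _ = ‖f - f'‖ := by rw [← Finset.sum_mul, h1, one_mul]

lemma continuous_nextMean (f : Ω → ℝ) (ω : Ω) :
    Continuous fun a : G.X × G.Y => G.nextMean f ω a.1 a.2 :=
  continuous_finsetSum _ fun ω' _ => ((continuous_apply ω').comp
    (continuous_subtype_val.comp (G.continuous_ρ ω))).mul continuous_const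

instance : Nonempty G.X := G.nonempty_X.to_subtype
instance : Nonempty G.Y := G.nonempty_Y.to_subtype

/-- `V n` is the value of the game where the total reward of `n` stages is paid. -/
structure IsTotalValue (R : Ω → G.X → G.Y → ℝ) (V : ℕ → Ω → ℝ) : Prop where
  zero : ∀ ω, V 0 ω = 0
  succ : ∀ n ω, IsMixedValue (fun x y => R ω x y + G.nextMean (V n) ω x y) (V (n + 1) ω)

/-- Shapley's equation for the discounted value. -/
def IsDiscValue (R : Ω → G.X → G.Y → ℝ) (lam : ℝ) (w : Ω → ℝ) : Prop :=
  ∀ ω, IsMixedValue (fun x y => lam * R ω x y + (1 - lam) * G.nextMean w ω x y) (w ω)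

variable {G} {R R' : Ω → G.X → G.Y → ℝ}

lemma exists_isTotalValue (hR : ∀ ω, Continuous fun a : G.X × G.Y => R ω a.1 a.2) :
    ∃ V, G.IsTotalValue R V := by
  have h : ∀ (f : Ω → ℝ) ω, ∃ v, IsMixedValue (fun x y => R ω x y + G.nextMean f ω x y) v :=
    fun f ω => exists_isMixedValue ((hR ω).add (G.continuous_nextMean f ω))
  choose T hT using h
  exact ⟨fun n => T^[n] 0, fun ω => rfl, fun n ω => by
    rw [Function.iterate_succ_apply']; exact hT _ ω⟩

/-- The Shapley operator contracts the sup norm by the factor `1 - lam`, so Banach's theorem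
applies. -/
lemma exists_isDiscValue (hR : ∀ ω, Continuous fun a : G.X × G.Y => R ω a.1 a.2) {lam : ℝ}
    (h0 : 0 < lam) (h1 : lam ≤ 1) : ∃ w, G.IsDiscValue R lam w := by
  have h : ∀ (f : Ω → ℝ) ω, ∃ v,
      IsMixedValue (fun x y => lam * R ω x y + (1 - lam) * G.nextMean f ω x y) v :=
    fun f ω => exists_isMixedValue
      (((hR ω).const_mul lam).add ((G.continuous_nextMean f ω).const_mul (1 - lam)))
  choose T hT using h
  have h1' : 0 ≤ 1 - lam := by linarith
  have hc : ContractingWith (1 - lam).toNNReal T := by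
    refine ⟨Real.toNNReal_lt_one.2 (by linarith), .of_dist_le_mul fun f f' => ?_⟩
    rw [dist_eq_norm, dist_eq_norm, Real.coe_toNNReal _ h1']
    refine (pi_norm_le_iff_of_nonneg (by positivity)).2 fun ω => ?_
    refine (hT f ω).abs_sub_le (hT f' ω) fun x y => ?_
    rw [add_sub_add_left_eq_sub, ← mul_sub, abs_mul, abs_of_nonneg h1']
    exact mul_le_mul_of_nonneg_left (G.abs_nextMean_sub_le f f' ω x y) h1'
  refine ⟨ContractingWith.fixedPoint T hc, fun ω => ?_⟩
  have := hT (ContractingWith.fixedPoint T hc) ω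
  rwa [hc.fixedPoint_isFixedPt] at this

/-- The distance `d` of the two values satisfies `d ≤ lam * c + (1 - lam) * d`. The resulting bound
is free of `lam`, which is what the approximation of rewards requires; it also gives uniqueness and
boundedness. -/
lemma IsDiscValue.norm_sub_le {lam : ℝ} (h0 : 0 < lam) (h1 : lam ≤ 1) {w w' : Ω → ℝ}
    (hw : G.IsDiscValue R lam w) (hw' : G.IsDiscValue R' lam w') {c : ℝ} (hc0 : 0 ≤ c)
    (hc : ∀ ω x y, |R ω x y - R' ω x y| ≤ c) : ‖w - w'‖ ≤ c := by
  have h1' : 0 ≤ 1 - lam := by linarith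
  have h : ‖w - w'‖ ≤ lam * c + (1 - lam) * ‖w - w'‖ := by
    refine (pi_norm_le_iff_of_nonneg (by positivity)).2 fun ω => ?_
    refine (hw ω).abs_sub_le (hw' ω) fun x y => ?_
    rw [add_sub_add_comm, ← mul_sub, ← mul_sub]
    refine (abs_add_le _ _).trans (add_le_add ?_ ?_)
    · rw [abs_mul, abs_of_pos h0]
      exact mul_le_mul_of_nonneg_left (hc ω x y) h0.le
    · rw [abs_mul, abs_of_nonneg h1']
      exact mul_le_mul_of_nonneg_left (G.abs_nextMean_sub_le w w' ω x y) h1'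
  nlinarith

lemma IsDiscValue.unique {lam : ℝ} (h0 : 0 < lam) (h1 : lam ≤ 1) {w w' : Ω → ℝ}
    (hw : G.IsDiscValue R lam w) (hw' : G.IsDiscValue R lam w') : w = w' :=
  sub_eq_zero.1 (norm_le_zero_iff.1 (hw.norm_sub_le h0 h1 hw' le_rfl (by simp)))

lemma IsDiscValue.norm_le {lam : ℝ} (h0 : 0 < lam) (h1 : lam ≤ 1) {w : Ω → ℝ}
    (hw : G.IsDiscValue R lam w) {c : ℝ} (hc0 : 0 ≤ c) (hc : ∀ ω x y, |R ω x y| ≤ c) :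
    ‖w‖ ≤ c := by
  have h : G.IsDiscValue (fun _ _ _ => 0) lam 0 := fun ω => by
    simpa [nextMean] using IsMixedValue.zero (A := G.X) (B := G.Y)
  simpa using hw.norm_sub_le h0 h1 h hc0 (by simpa using hc)

lemma IsTotalValue.norm_sub_le {V V' : ℕ → Ω → ℝ} (hV : G.IsTotalValue R V)
    (hV' : G.IsTotalValue R' V') {c : ℝ} (hc0 : 0 ≤ c)
    (hc : ∀ ω x y, |R ω x y - R' ω x y| ≤ c) (n : ℕ) : ‖V n - V' n‖ ≤ n * c := by
  induction n with
  | zero => simp [show V 0 = V' 0 from funext fun ω => (hV.zero ω).trans (hV'.zero ω).symm]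
  | succ n ih =>
    refine (pi_norm_le_iff_of_nonneg (by positivity)).2 fun ω => ?_
    refine (hV.succ n ω).abs_sub_le (hV'.succ n ω) fun x y => ?_
    rw [add_sub_add_comm]
    push_cast
    linarith [abs_add_le (R ω x y - R' ω x y)
      (G.nextMean (V n) ω x y - G.nextMean (V' n) ω x y), hc ω x y,
      G.abs_nextMean_sub_le (V n) (V' n) ω x y]

/-- Comparison of the total values with the discounted values of discount rate `1 / n`. -/
lemma IsTotalValue.norm_sub_disc_le {V : ℕ → Ω → ℝ} (hV : G.IsTotalValue R V) {w : ℝ → Ω → ℝ}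
    (hw : ∀ lam, 0 < lam → lam ≤ 1 → G.IsDiscValue R lam (w lam)) (n : ℕ) :
    ‖V (n + 1) - ((n + 1 : ℕ) : ℝ) • w (1 / (n + 1 : ℕ))‖ ≤
      ‖V n - (n : ℝ) • w (1 / n)‖ + n * ‖w (1 / n) - w (1 / (n + 1 : ℕ))‖ := by
  -- When `n = 0` the meaningless vector `w (1 / 0)` occurs only with coefficient `0`.
  have hn : (0 : ℝ) < (n + 1 : ℕ) := by positivity
  set u := w (1 / (n + 1 : ℕ)) with hu
  have h1 : ‖V (n + 1) - ((n + 1 : ℕ) : ℝ) • u‖ ≤ ‖V n - (n : ℝ) • u‖ := by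
    refine (pi_norm_le_iff_of_nonneg (norm_nonneg _)).2 fun ω => ?_
    -- Multiplied by `n + 1`, Shapley's equation at rate `1 / (n + 1)` has payoff `R + n * E[u]`:
    -- the one-shot game defining `V (n + 1)`, with continuation `n • u` in place of `V n`.
    have h2 := (hw (1 / (n + 1 : ℕ)) (by positivity)
      ((div_le_one hn).2 (by exact_mod_cast Nat.le_add_left 1 n)) ω).const_mul hn
    refine (hV.succ n ω).abs_sub_le h2 fun x y => ?_
    refine le_trans (le_of_eq ?_) (G.abs_nextMean_sub_le _ _ ω x y)
    have h3 : G.nextMean ((n : ℝ) • u) ω x y = n * G.nextMean u ω x y := G.nextMean_mul _ _ _ _ _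
    rw [h3, ← hu]
    congr 1
    push_cast at hn ⊢
    field_simp
    ring
  refine h1.trans ?_
  calc _ = ‖(V n - (n : ℝ) • w (1 / n)) + (n : ℝ) • (w (1 / n) - u)‖ := by
        congr 1; rw [smul_sub]; abel
    _ ≤ _ := (norm_add_le _ _).trans_eq (by rw [norm_smul, Real.norm_natCast])

/-- If the discounted values converge, and are eventually monotone along `1 / n`, then the mean
values of the finitely repeated games have the same limit. -/
lemma IsTotalValue.tendsto {V : ℕ → Ω → ℝ} (hV : G.IsTotalValue R V) {w : ℝ → Ω → ℝ}
    (hw : ∀ lam, 0 < lam → lam ≤ 1 → G.IsDiscValue R lam (w lam)) {L : Ω → ℝ}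
    (hL : Tendsto w (𝓝[>] 0) (𝓝 L))
    (hmono : ∀ ω, (∀ᶠ n : ℕ in atTop, w (1 / n) ω ≤ w (1 / (n + 1 : ℕ)) ω) ∨
      ∀ᶠ n : ℕ in atTop, w (1 / (n + 1 : ℕ)) ω ≤ w (1 / n) ω) :
    Tendsto (fun n ω => V n ω / n) atTop (𝓝 L) := by
  have hinv : Tendsto (fun n : ℕ => 1 / (n : ℝ)) atTop (𝓝[>] 0) := by
    simpa [Function.comp_def] using tendsto_inv_atTop_nhdsGT_zero.comp tendsto_natCast_atTop_atTop
  have hwL := hL.comp hinv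
  have hlim : ∀ ω, Tendsto (fun n : ℕ => w (1 / n) ω) atTop (𝓝 (L ω)) :=
    fun ω => (tendsto_pi_nhds.1 hwL) ω
  -- A monotone sequence approaches its limit from one side, so the size of each increment is the
  -- decrease of the distance to the limit.
  have hinc : ∀ ω, ∀ᶠ n : ℕ in atTop, |w (1 / n) ω - w (1 / (n + 1 : ℕ)) ω| =
      |w (1 / n) ω - L ω| - |w (1 / (n + 1 : ℕ)) ω - L ω| := by
    intro ω
    rcases hmono ω with h | h
    · obtain ⟨N, hN⟩ := eventually_atTop.1 h
      filter_upwards [eventually_ge_atTop N] with n hn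
      have hle : ∀ n ≥ N, w (1 / n) ω ≤ L ω := fun n hn => by
        refine ge_of_tendsto (hlim ω) ?_
        filter_upwards [eventually_ge_atTop n] with m hm
        induction m, hm using Nat.le_induction with
        | base => rfl
        | succ m hm ih => exact ih.trans (hN m (hn.trans hm))
      rw [abs_of_nonpos, abs_of_nonpos, abs_of_nonpos] <;>
        linarith [hN n hn, hle n hn, hle (n + 1) (hn.trans n.le_succ)]
    · obtain ⟨N, hN⟩ := eventually_atTop.1 h
      filter_upwards [eventually_ge_atTop N] with n hn
      have hle : ∀ n ≥ N, L ω ≤ w (1 / n) ω := fun n hn => by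
        refine le_of_tendsto (hlim ω) ?_
        filter_upwards [eventually_ge_atTop n] with m hm
        induction m, hm using Nat.le_induction with
        | base => rfl
        | succ m hm ih => exact (hN m (hn.trans hm)).trans ih
      rw [abs_of_nonneg, abs_of_nonneg, abs_of_nonneg] <;>
        linarith [hN n hn, hle n hn, hle (n + 1) (hn.trans n.le_succ)]
  obtain ⟨N, hN⟩ := eventually_atTop.1 (eventually_all.2 hinc)
  have key := tendsto_div_of_increment_le (D := fun n => ‖V n - (n : ℝ) • w (1 / n)‖)
    (t := fun n => ∑ ω, |w (1 / n) ω - L ω|) (N := N) (fun _ => norm_nonneg _)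
    (fun _ => Finset.sum_nonneg fun _ _ => abs_nonneg _)
    (by
      simpa using tendsto_finsetSum Finset.univ
        fun ω _ => ((hlim ω).sub_const (L ω)).abs)
    fun n hn => by
      refine (hV.norm_sub_disc_le hw n).trans (add_le_add le_rfl
        (mul_le_mul_of_nonneg_left ?_ (Nat.cast_nonneg n)))
      rw [← Finset.sum_sub_distrib]
      simp only [← hN n hn]
      refine (pi_norm_le_iff_of_nonneg (Finset.sum_nonneg fun _ _ => abs_nonneg _)).2 fun ω => ?_
      exact Finset.single_le_sum (f := fun ω => |w (1 / n) ω - w (1 / (n + 1 : ℕ)) ω|)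
        (fun _ _ => abs_nonneg _) (Finset.mem_univ ω)
  rw [tendsto_iff_norm_sub_tendsto_zero]
  have key' := key.add (tendsto_iff_norm_sub_tendsto_zero.1 hwL)
  rw [add_zero] at key'
  refine squeeze_zero' (.of_forall fun _ => norm_nonneg _) ?_ key'
  filter_upwards [eventually_gt_atTop 0] with n hn
  have hn' : (0 : ℝ) < n := by exact_mod_cast hn
  have : ((fun ω => V n ω / n) - L) =
      (n : ℝ)⁻¹ • (V n - (n : ℝ) • w (1 / n)) + (w (1 / n) - L) := by
    ext ω
    simp only [Pi.sub_apply, Pi.add_apply, Pi.smul_apply, smul_eq_mul]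
    field_simp
    ring
  rw [this]
  refine (norm_add_le _ _).trans_eq ?_
  rw [norm_smul, norm_inv, Real.norm_natCast, ← div_eq_inv_mul]
  rfl

end StochasticGame

/-! ### Definability of Shapley's equation -/

namespace OMinStructure

variable {O : OMinStructure} {ι : Type*}

/-- If `S` has points arbitrarily close to `0` on the right, then by convexity it contains
everything between them and a fixed one of its points; otherwise it misses some `Ioo 0 ε`. -/
lemma _root_.Set.OrdConnected.eventually_nhdsGT_zero {S : Set ℝ} (hS : S.OrdConnected) :
    (∀ᶠ x in 𝓝[>] (0 : ℝ), x ∈ S) ∨ ∀ᶠ x in 𝓝[>] (0 : ℝ), x ∉ S := by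
  by_cases h : ∀ ε > (0 : ℝ), ∃ x ∈ S, x ∈ Ioo 0 ε
  · obtain ⟨s, hs, hs0⟩ := h 1 one_pos
    left
    filter_upwards [Ioo_mem_nhdsGT hs0.1] with x hx
    obtain ⟨s', hs', hs0'⟩ := h x hx.1
    exact hS.out hs' hs ⟨hs0'.2.le, hx.2.le⟩
  · push Not at h
    obtain ⟨ε, hε, h⟩ := h
    right
    filter_upwards [Ioo_mem_nhdsGT hε] with x hx hxS
    exact h x hxS hx

/-- A definable property of reals is eventually true or eventually false near `0`. -/
lemma DefPred.eventually_or {P : ℝ → Prop} (h : O.DefPred fun z : Unit → ℝ => P (z ())) :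
    (∀ᶠ x in 𝓝[>] (0 : ℝ), P x) ∨ ∀ᶠ x in 𝓝[>] (0 : ℝ), ¬ P x := by
  have h1 : {z : Fin 1 → ℝ | P (z 0)} ∈ O.sets 1 := (h.reindex fun _ => (0 : Fin 1)).mem_sets
  obtain ⟨F, hF, hord, hPF⟩ := (O.mem_one_iff _).1 h1
  have hP : ∀ x, P x ↔ ∃ I ∈ F, x ∈ I := fun x => by
    simpa using Set.ext_iff.1 hPF fun _ => x
  by_cases h : ∃ I ∈ F, ∀ᶠ x in 𝓝[>] (0 : ℝ), x ∈ I
  · obtain ⟨I, hI, h⟩ := h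
    exact .inl (h.mono fun x hx => (hP x).2 ⟨I, hI, hx⟩)
  · right
    have := (eventually_all_finite hF).2
      fun I hI => ((hord I hI).eventually_nhdsGT_zero).resolve_left fun h' => h ⟨I, hI, h'⟩
    filter_upwards [this] with x hx
    rw [hP]
    rintro ⟨I, hI, hxI⟩
    exact hx I hI hxI

/-- It is a definable property of the parameters of a definable game that the first player can
guarantee a definable level with mixed actions carried by `N` points. -/
lemma defPred_guarantee [Finite ι] {p q : ℕ} {X : Set (Fin p → ℝ)} {Y : Set (Fin q → ℝ)}
    (hX : X ∈ O.sets p) (hY : Y ∈ O.sets q) (N : ℕ)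
    {h : (ι → ℝ) → (Fin p ⊕ Fin q → ℝ) → ℝ} {c : (ι → ℝ) → ℝ}
    (hh : O.DefMap fun z : ι ⊕ (Fin p ⊕ Fin q) → ℝ => h (z ∘ Sum.inl) (z ∘ Sum.inr))
    (hc : O.DefMap c) :
    O.DefPred fun z => ∀ ε > 0, ∃ μ : FinProb N X, ∀ y : Y,
      c z - ε ≤ μ.avg fun x => h z (Sum.elim x y) := by
  -- With `N` fixed, a mixed action is a tuple of `N` weights and `N * p` coordinates, so
  -- quantifying over mixed actions is quantifying over finitely many reals.
  have key : O.DefPred fun z : ι → ℝ => ∀ ε : Unit → ℝ, 0 < ε () →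
      ∃ μ : Fin N ⊕ (Fin N × Fin p) → ℝ, (∀ k, 0 ≤ μ (.inl k)) ∧ ∑ k, μ (.inl k) = 1 ∧
        (∀ k, (fun i => μ (.inr (k, i))) ∈ X) ∧ ∀ y : Fin q → ℝ, y ∈ Y →
          c z - ε () ≤ ∑ k, μ (.inl k) * h z (Sum.elim (fun i => μ (.inr (k, i))) y) := by
    refine DefPred.all (.imp (DefMap.lt (.const 0) (.proj _)) (DefPred.ex (.and ?_ (.and ?_
      (.and ?_ (DefPred.all (.imp ?_ ?_)))))))
    · exact .forall_finite fun k => DefMap.le (.const 0) (.proj _)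
    · exact DefMap.eq (.sum fun k => .proj _) (.const 1)
    · exact .forall_finite fun k => (defPred_of_mem_sets hX).reindex _
    · exact (defPred_of_mem_sets hY).reindex _
    · refine DefMap.le (.sub (hc.reindex _) (.proj _)) (.sum fun k => .mul (.proj _) ?_)
      have := hh.reindex (κ := ((ι ⊕ Unit) ⊕ (Fin N ⊕ Fin N × Fin p)) ⊕ Fin q)
        (Sum.elim (Sum.inl ∘ Sum.inl ∘ Sum.inl)
          (Sum.elim (fun i => Sum.inl (Sum.inr (Sum.inr (k, i)))) Sum.inr))
      convert this using 2 with z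
      refine congrArg₂ h rfl (funext ?_)
      rintro (i | j) <;> rfl
  convert key using 2 with z
  constructor
  · intro H ε hε
    obtain ⟨μ, hμ⟩ := H (ε ()) hε
    refine ⟨Sum.elim μ.weight fun a => (μ.point a.1 : Fin p → ℝ) a.2, μ.weight_nonneg,
      μ.weight_sum, fun k => (μ.point k).2, fun y hy => ?_⟩
    exact hμ ⟨y, hy⟩
  · intro H ε hε
    obtain ⟨μ, h0, h1, hx, hμ⟩ := H (fun _ => ε) hε
    exact ⟨⟨fun k => μ (.inl k), fun k => ⟨_, hx k⟩, h0, h1⟩, fun y => hμ y y.2⟩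

end OMinStructure

/-- The partial functions `f · y` span a finite-dimensional space. -/
def HasFiniteRank {A B : Type*} (f : A → B → ℝ) : Prop :=
  ∃ V : Submodule ℝ (A → ℝ), FiniteDimensional ℝ V ∧ ∀ y, (fun x => f x y) ∈ V

namespace HasFiniteRank

variable {A B : Type*}

lemma of_sum {ι : Type*} [Finite ι] {f : A → B → ℝ} (a : ι → A → ℝ)
    (h : ∀ y, (fun x => f x y) ∈ Submodule.span ℝ (range a)) : HasFiniteRank f :=
  ⟨_, FiniteDimensional.span_of_finite ℝ (finite_range a), h⟩

lemma exists_common {ι : Type*} [Finite ι] {f : ι → A → B → ℝ} (hf : ∀ i, HasFiniteRank (f i)) :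
    ∃ V : Submodule ℝ (A → ℝ), FiniteDimensional ℝ V ∧ ∀ i y, (fun x => f i x y) ∈ V := by
  choose V hV hfV using hf
  exact ⟨⨆ i, V i, Submodule.finiteDimensional_iSup V,
    fun i y => Submodule.mem_iSup_of_mem i (hfV i y)⟩

/-- Collecting the monomials of `P`, each partial function in `x` is a combination of the `x`-parts
of the monomials, with coefficients depending on `y`. -/
lemma eval {κ₁ κ₂ : Type*} [Fintype κ₁] [Fintype κ₂] (P : MvPolynomial (κ₁ ⊕ κ₂) ℝ)
    (a : A → κ₁ → ℝ) (b : B → κ₂ → ℝ) :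
    HasFiniteRank fun x y => MvPolynomial.eval (Sum.elim (a x) (b y)) P := by
  refine of_sum (ι := P.support) (fun d x => ∏ i, a x i ^ (d : κ₁ ⊕ κ₂ →₀ ℕ) (Sum.inl i))
    fun y => ?_
  have : (fun x => MvPolynomial.eval (Sum.elim (a x) (b y)) P) = ∑ d : P.support,
      (P.coeff d * ∏ j, b y j ^ (d : κ₁ ⊕ κ₂ →₀ ℕ) (Sum.inr j)) •
        fun x => ∏ i, a x i ^ (d : κ₁ ⊕ κ₂ →₀ ℕ) (Sum.inl i) := by
    ext x
    rw [MvPolynomial.eval_eq', ← Finset.sum_coe_sort, Finset.sum_apply]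
    refine Finset.sum_congr rfl fun d _ => ?_
    simp only [Fintype.prod_sum_type, Sum.elim_inl, Sum.elim_inr, Pi.smul_apply, smul_eq_mul]
    ring
  rw [this]
  exact Submodule.sum_mem _ fun d _ => Submodule.smul_mem _ _ (Submodule.subset_span ⟨d, rfl⟩)

end HasFiniteRank

namespace IsSeparableFun

variable {A B : Type*} [TopologicalSpace A] [TopologicalSpace B] {f : A → B → ℝ}

lemma swap (h : IsSeparableFun f) : IsSeparableFun fun y x => f x y := by
  obtain ⟨I, J, m, a, b, ha, hb, hf⟩ := h
  refine ⟨J, I, fun j i => m i j, b, a, hb, ha, fun y x => ?_⟩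
  change f x y = _
  rw [hf, Finset.sum_comm]
  exact Finset.sum_congr rfl fun _ _ => Finset.sum_congr rfl fun _ _ => by ring

lemma hasFiniteRank (h : IsSeparableFun f) : HasFiniteRank f := by
  obtain ⟨I, J, m, a, b, -, -, hf⟩ := h
  refine .of_sum a fun y => ?_
  have : (fun x => f x y) = ∑ i, (∑ j, m i j * b j y) • a i := by
    ext x
    simp only [hf, Finset.sum_apply, Pi.smul_apply, smul_eq_mul, Finset.sum_mul]
    exact Finset.sum_congr rfl fun _ _ => Finset.sum_congr rfl fun _ _ => by ring
  rw [this]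
  exact Submodule.sum_mem _ fun i _ => Submodule.smul_mem _ _ (Submodule.subset_span ⟨i, rfl⟩)

end IsSeparableFun

/-- The mixed value of a game of finite rank, in terms of mixed actions carried by a bounded number
of points. -/
lemma isMixedValue_iff_of_mem {A B : Type*} {h : A → B → ℝ} {v : ℝ} (V : Submodule ℝ (A → ℝ))
    [FiniteDimensional ℝ V] (W : Submodule ℝ (B → ℝ)) [FiniteDimensional ℝ W]
    (hV : ∀ y, (fun x => h x y) ∈ V) (hW : ∀ x, h x ∈ W) :
    IsMixedValue h v ↔
      (∀ ε > 0, ∃ μ : FinProb (Module.finrank ℝ V + 1) A, ∀ y, v - ε ≤ μ.avg fun x => h x y) ∧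
      ∀ ε > 0, ∃ ν : FinProb (Module.finrank ℝ W + 1) B, ∀ x, -v - ε ≤ ν.avg fun y => -h x y := by
  constructor
  · intro hv
    constructor <;> intro ε hε
    · obtain ⟨n, μ, hμ⟩ := (hv ε hε).1
      obtain ⟨μ', h'⟩ := μ.exists_avg_eq V
      exact ⟨μ', fun y => (hμ y).trans_eq (h' _ (hV y)).symm⟩
    · obtain ⟨n, ν, hν⟩ := (hv ε hε).2
      obtain ⟨ν', h'⟩ := ν.exists_avg_eq W
      refine ⟨ν', fun x => ?_⟩
      rw [FinProb.avg_neg]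
      linarith [hν x, h' _ (hW x)]
  · rintro ⟨h1, h2⟩ ε hε
    obtain ⟨μ, hμ⟩ := h1 ε hε
    obtain ⟨ν, hν⟩ := h2 ε hε
    refine ⟨⟨_, μ, hμ⟩, _, ν, fun x => ?_⟩
    have := hν x
    rw [FinProb.avg_neg] at this
    linarith

/-- A definable function on `X × Y` extends to a definable function. -/
lemma OMinStructure.DefinableFun.exists_defMap {O : OMinStructure} {p q : ℕ}
    {X : Set (Fin p → ℝ)} {Y : Set (Fin q → ℝ)} (hX : X ∈ O.sets p) (hY : Y ∈ O.sets q)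
    {f : X → Y → ℝ} (hf : O.DefinableFun f) :
    ∃ F : (Fin p ⊕ Fin q → ℝ) → ℝ, O.DefMap F ∧ ∀ (x : X) (y : Y), F (Sum.elim x y) = f x y := by
  classical
  let F : (Fin p ⊕ Fin q → ℝ) → ℝ := fun z =>
    if h : z ∘ Sum.inl ∈ X ∧ z ∘ Sum.inr ∈ Y then f ⟨_, h.1⟩ ⟨_, h.2⟩ else 0
  have hF : ∀ (x : X) (y : Y), F (Sum.elim x y) = f x y := fun x y => dif_pos ⟨x.2, y.2⟩
  exact ⟨F, hf.defMap hX hY hF fun z hz => dif_neg hz, hF⟩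

namespace StochasticGame

open OMinStructure

variable {Ω : Type*} [Fintype Ω] {p q : ℕ} {G : StochasticGame Ω p q} {O : OMinStructure}

lemma exists_isDiscValue_family {R : Ω → G.X → G.Y → ℝ}
    (hR : ∀ ω, Continuous fun a : G.X × G.Y => R ω a.1 a.2) :
    ∃ w : ℝ → Ω → ℝ, ∀ lam, 0 < lam → lam ≤ 1 → G.IsDiscValue R lam (w lam) := by
  have h : ∀ lam : ℝ, ∃ w, 0 < lam → lam ≤ 1 → G.IsDiscValue R lam w := by
    intro lam
    by_cases h : 0 < lam ∧ lam ≤ 1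
    · obtain ⟨w, hw⟩ := exists_isDiscValue hR h.1 h.2
      exact ⟨w, fun _ _ => hw⟩
    -- Outside `(0, 1]` nothing is required and the zero vector serves as filler.
    · exact ⟨0, fun h0 h1 => absurd ⟨h0, h1⟩ h⟩
  choose w hw using h
  exact ⟨w, hw⟩

/-- A reward function given by polynomials. -/
noncomputable def polyReward (G : StochasticGame Ω p q)
    (P : Ω → MvPolynomial (Fin p ⊕ Fin q) ℝ) (ω : Ω) (x : G.X) (y : G.Y) : ℝ :=
  MvPolynomial.eval (Sum.elim (x : Fin p → ℝ) (y : Fin q → ℝ)) (P ω)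

lemma continuous_polyReward (P : Ω → MvPolynomial (Fin p ⊕ Fin q) ℝ) (ω : Ω) :
    Continuous fun a : G.X × G.Y => G.polyReward P ω a.1 a.2 := by
  refine (MvPolynomial.continuous_eval (P ω)).comp (continuous_pi ?_)
  rintro (i | j)
  · exact (continuous_apply i).comp (continuous_subtype_val.comp continuous_fst)
  · exact (continuous_apply j).comp (continuous_subtype_val.comp continuous_snd)

/-- Shapley's equation is definable. -/
lemma defPred_isDiscValue (hX : G.X ∈ O.sets p) (hY : G.Y ∈ O.sets q)
    (hdef : ∀ ω ω' : Ω, O.DefinableFun fun x y => G.ρ ω x y ω')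
    (hsep : ∀ ω ω' : Ω, IsSeparableFun fun x y => G.ρ ω x y ω')
    (P : Ω → MvPolynomial (Fin p ⊕ Fin q) ℝ) :
    O.DefPred fun z : Unit ⊕ Ω → ℝ =>
      G.IsDiscValue (G.polyReward P) (z (Sum.inl ())) (z ∘ Sum.inr) := by
  have h1 (ω) : HasFiniteRank (G.polyReward P ω) :=
    .eval (P ω) (fun x : G.X => (x : Fin p → ℝ)) (fun y : G.Y => (y : Fin q → ℝ))
  have h2 (ω) : HasFiniteRank fun y x => G.polyReward P ω x y := by
    convert HasFiniteRank.eval (MvPolynomial.rename Sum.swap (P ω))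
      (fun y : G.Y => (y : Fin q → ℝ)) (fun x : G.X => (x : Fin p → ℝ)) using 3 with y x
    rw [MvPolynomial.eval_rename, polyReward]
    congr 1
    congr 1
    ext (i | j) <;> rfl
  -- These spaces depend neither on the discount rate nor on the continuation vector, so one bound
  -- on the number of support points works for all `z`.
  obtain ⟨V₁, _, hV₁⟩ := HasFiniteRank.exists_common h1
  obtain ⟨W₁, _, hW₁⟩ := HasFiniteRank.exists_common h2
  obtain ⟨V₂, _, hV₂⟩ := HasFiniteRank.exists_common fun a : Ω × Ω => (hsep a.1 a.2).hasFiniteRank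
  obtain ⟨W₂, _, hW₂⟩ :=
    HasFiniteRank.exists_common fun a : Ω × Ω => (hsep a.1 a.2).swap.hasFiniteRank
  choose F hF hFρ using fun ω ω' => (hdef ω ω').exists_defMap hX hY
  let h : Ω → (Unit ⊕ Ω → ℝ) → (Fin p ⊕ Fin q → ℝ) → ℝ := fun ω z a =>
    z (Sum.inl ()) * MvPolynomial.eval a (P ω) +
      (1 - z (Sum.inl ())) * ∑ ω', F ω ω' a * z (Sum.inr ω')
  have hh (ω) : O.DefMap fun z : (Unit ⊕ Ω) ⊕ (Fin p ⊕ Fin q) → ℝ =>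
      h ω (z ∘ Sum.inl) (z ∘ Sum.inr) :=
    ((DefMap.proj _).mul ((DefMap.poly (P ω)).reindex _)).add
      (((DefMap.const 1).sub (.proj _)).mul (.sum fun ω' => ((hF ω ω').reindex _).mul (.proj _)))
  have hgame (ω z) (x : G.X) (y : G.Y) : h ω z (Sum.elim x y) =
      z (Sum.inl ()) * G.polyReward P ω x y +
        (1 - z (Sum.inl ())) * G.nextMean (z ∘ Sum.inr) ω x y := by
    simp only [h, hFρ, nextMean, polyReward, Function.comp_apply]
  have key : O.DefPred fun z : Unit ⊕ Ω → ℝ => ∀ ω,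
      (∀ ε > 0, ∃ μ : FinProb (Module.finrank ℝ (V₁ ⊔ V₂ : Submodule ℝ (G.X → ℝ)) + 1) G.X,
        ∀ y : G.Y, z (Sum.inr ω) - ε ≤ μ.avg fun x => h ω z (Sum.elim x y)) ∧
      ∀ ε > 0, ∃ ν : FinProb (Module.finrank ℝ (W₁ ⊔ W₂ : Submodule ℝ (G.Y → ℝ)) + 1) G.Y,
        ∀ x : G.X, -z (Sum.inr ω) - ε ≤ ν.avg fun y => -h ω z (Sum.elim y x ∘ Sum.swap) := by
    -- Player 2's guarantee is a first-player guarantee in the negated game with the roles of `X`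
    -- and `Y` exchanged.
    refine .forall_finite fun ω => .and (defPred_guarantee hX hY _ (hh ω) (.proj _))
      (defPred_guarantee hY hX _ (h := fun z a => -h ω z (a ∘ Sum.swap)) ?_ ?_)
    · exact ((hh ω).reindex (Sum.map id Sum.swap)).neg
    · exact (DefMap.proj (Sum.inr ω)).neg
  convert key using 2 with z
  refine forall_congr' fun ω => ?_
  rw [isMixedValue_iff_of_mem (V₁ ⊔ V₂) (W₁ ⊔ W₂)]
  · simp only [hgame, Sum.elim_swap, Function.comp_apply]
  · intro y
    have : (fun x => z (Sum.inl ()) * G.polyReward P ω x y +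
        (1 - z (Sum.inl ())) * G.nextMean (z ∘ Sum.inr) ω x y) =
        z (Sum.inl ()) • (fun x => G.polyReward P ω x y) +
          (1 - z (Sum.inl ())) • ∑ ω', z (Sum.inr ω') • fun x => (G.ρ ω x y ω' : ℝ) := by
      ext x
      simp [nextMean, Finset.sum_apply, mul_comm]
    rw [this]
    exact Submodule.add_mem_sup (Submodule.smul_mem _ _ (hV₁ ω y)) (Submodule.smul_mem _ _
      (Submodule.sum_mem _ fun ω' _ => Submodule.smul_mem _ _ (hV₂ (ω, ω') y)))
  · intro x
    have : (fun y => z (Sum.inl ()) * G.polyReward P ω x y +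
        (1 - z (Sum.inl ())) * G.nextMean (z ∘ Sum.inr) ω x y) =
        z (Sum.inl ()) • (fun y => G.polyReward P ω x y) +
          (1 - z (Sum.inl ())) • ∑ ω', z (Sum.inr ω') • fun y => (G.ρ ω x y ω' : ℝ) := by
      ext y
      simp [nextMean, Finset.sum_apply, mul_comm]
    rw [this]
    exact Submodule.add_mem_sup (Submodule.smul_mem _ _ (hW₁ ω x)) (Submodule.smul_mem _ _
      (Submodule.sum_mem _ fun ω' _ => Submodule.smul_mem _ _ (hW₂ (ω, ω') x)))

/-! ### Asymptotics of discounted values for polynomial rewards -/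

section Polynomial

variable {P : Ω → MvPolynomial (Fin p ⊕ Fin q) ℝ} {w : ℝ → Ω → ℝ}

/-- The discounted values converge when Shapley's equation is definable. -/
lemma exists_tendsto_discValue
    (hw : ∀ lam, 0 < lam → lam ≤ 1 → G.IsDiscValue (G.polyReward P) lam (w lam))
    (hD : O.DefPred fun z : Unit ⊕ Ω → ℝ =>
      G.IsDiscValue (G.polyReward P) (z (Sum.inl ())) (z ∘ Sum.inr)) :
    ∃ L, Tendsto w (𝓝[>] 0) (𝓝 L) := by
  have h01 : ∀ᶠ x in 𝓝[>] (0 : ℝ), 0 < x ∧ x ≤ 1 :=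
    (Ioc_mem_nhdsGT one_pos : Ioc (0 : ℝ) 1 ∈ 𝓝[>] 0)
  have hcut : ∀ ω c, (∀ᶠ x in 𝓝[>] (0 : ℝ), c < w x ω) ∨ ∀ᶠ x in 𝓝[>] (0 : ℝ), w x ω ≤ c := by
    intro ω c
    -- The chosen family `w` is replaced by a quantifier over solutions of Shapley's equation, which
    -- is definable; uniqueness (`hiff`) makes the two conditions agree on `(0, 1]`.
    have h := DefPred.eventually_or (O := O)
      (P := fun x => ∃ f : Ω → ℝ, G.IsDiscValue (G.polyReward P) x f ∧ c < f ω)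
      (DefPred.ex (hD.and ((DefMap.const c).lt (.proj _))))
    have hiff : ∀ x, 0 < x → x ≤ 1 →
        ((∃ f : Ω → ℝ, G.IsDiscValue (G.polyReward P) x f ∧ c < f ω) ↔ c < w x ω) := by
      refine fun x h0 h1 => ⟨?_, fun h => ⟨_, hw x h0 h1, h⟩⟩
      rintro ⟨f, hf, hc⟩
      rwa [(hw x h0 h1).unique h0 h1 hf]
    refine h.imp (fun h => ?_) fun h => ?_
    · filter_upwards [h, h01] with x hx hx'
      exact (hiff x hx'.1 hx'.2).1 hx
    · filter_upwards [h, h01] with x hx hx'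
      rwa [hiff x hx'.1 hx'.2, not_lt] at hx
  obtain ⟨C, hC0, hC⟩ := exists_bound (G := G) (continuous_polyReward P)
  have hbdd : ∀ ω, ∀ᶠ x in 𝓝[>] (0 : ℝ), |w x ω| ≤ C := fun ω => by
    filter_upwards [h01] with x hx
    exact (norm_le_pi_norm (w x) ω).trans ((hw x hx.1 hx.2).norm_le hx.1 hx.2 hC0 hC)
  have hlim : ∀ ω, ∃ l, Tendsto (fun x => w x ω) (𝓝[>] 0) (𝓝 l) := fun ω => by
    -- A bounded function without a limit would cross some pair `a < b` infinitely often, which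
    -- `hcut` at level `a` forbids.
    refine tendsto_of_no_upcrossings dense_univ ?_
      ⟨C, (eventually_map.2 ((hbdd ω).mono fun x hx => (abs_le.1 hx).2))⟩
      ⟨-C, (eventually_map.2 ((hbdd ω).mono fun x hx => (abs_le.1 hx).1))⟩
    rintro a - b - hab ⟨h1, h2⟩
    rcases hcut ω a with h | h
    · exact h1 (h.mono fun x hx => hx.le.not_gt)
    · exact h2 (h.mono fun x hx => (hx.trans hab.le).not_gt)
  choose L hL using hlim
  exact ⟨L, tendsto_pi_nhds.2 hL⟩

/-- The discounted values are eventually monotone along `1 / n` when Shapley's equation is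
definable. -/
lemma eventually_monotone_discValue
    (hw : ∀ lam, 0 < lam → lam ≤ 1 → G.IsDiscValue (G.polyReward P) lam (w lam))
    (hD : O.DefPred fun z : Unit ⊕ Ω → ℝ =>
      G.IsDiscValue (G.polyReward P) (z (Sum.inl ())) (z ∘ Sum.inr)) (ω : Ω) :
    (∀ᶠ n : ℕ in atTop, w (1 / n) ω ≤ w (1 / (n + 1 : ℕ)) ω) ∨
      ∀ᶠ n : ℕ in atTop, w (1 / (n + 1 : ℕ)) ω ≤ w (1 / n) ω := by
  -- The vector `u` carries the rate `x / (1 + x)` in its first coordinate and the corresponding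
  -- value in the others. The map `x ↦ x / (1 + x)` sends `1 / n` to `1 / (n + 1)`, so a definable
  -- alternative in `x` decides the monotonicity along `1 / n`.
  have h := DefPred.eventually_or (O := O)
    (P := fun x => ∃ u : Unit ⊕ Ω → ℝ, u (Sum.inl ()) * (1 + x) = x ∧
      G.IsDiscValue (G.polyReward P) (u (Sum.inl ())) (u ∘ Sum.inr) ∧ ∃ f : Ω → ℝ,
        G.IsDiscValue (G.polyReward P) x f ∧ f ω < u (Sum.inr ω))
    (DefPred.ex (.and (DefMap.eq (.mul (.proj _) (.add (.const 1) (.proj _))) (.proj _))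
      (.and (hD.reindex Sum.inr) (DefPred.ex (.and
        (hD.reindex (Sum.map Sum.inl id)) (DefMap.lt (.proj _) (.proj _)))))))
  have hiff : ∀ x, 0 < x → x ≤ 1 → ((∃ u : Unit ⊕ Ω → ℝ, u (Sum.inl ()) * (1 + x) = x ∧
      G.IsDiscValue (G.polyReward P) (u (Sum.inl ())) (u ∘ Sum.inr) ∧ ∃ f : Ω → ℝ,
        G.IsDiscValue (G.polyReward P) x f ∧ f ω < u (Sum.inr ω)) ↔
          w x ω < w (x / (1 + x)) ω) := by
    intro x h0 h1
    have hpos : 0 < x / (1 + x) := by positivity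
    have hle : x / (1 + x) ≤ 1 := (div_le_one (by positivity)).2 (by linarith)
    constructor
    · rintro ⟨u, hu, hu', f, hf, hlt⟩
      rw [← eq_div_iff (by positivity)] at hu
      rw [hu] at hu'
      rw [(hw x h0 h1).unique h0 h1 hf, (hw _ hpos hle).unique hpos hle hu']
      exact hlt
    · intro h
      refine ⟨Sum.elim (fun _ => x / (1 + x)) (w (x / (1 + x))), ?_, hw _ hpos hle, w x,
        hw x h0 h1, h⟩
      simp only [Sum.elim_inl]
      field_simp
  have hinv : Tendsto (fun n : ℕ => 1 / (n : ℝ)) atTop (𝓝[>] 0) := by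
    simpa [Function.comp_def] using tendsto_inv_atTop_nhdsGT_zero.comp tendsto_natCast_atTop_atTop
  have hn : ∀ᶠ n : ℕ in atTop, 0 < 1 / (n : ℝ) ∧ 1 / (n : ℝ) ≤ 1 ∧
      1 / (n : ℝ) / (1 + 1 / (n : ℝ)) = 1 / (n + 1 : ℕ) := by
    filter_upwards [eventually_gt_atTop 0] with n hn
    have : (1 : ℝ) ≤ n := by exact_mod_cast hn
    refine ⟨by positivity, (div_le_one (by positivity)).2 this, ?_⟩
    push_cast
    field_simp
  refine h.imp (fun h => ?_) fun h => ?_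
  · filter_upwards [hinv.eventually h, hn] with n h hn
    rw [hiff _ hn.1 hn.2.1, hn.2.2] at h
    exact h.le
  · filter_upwards [hinv.eventually h, hn] with n h hn
    rw [hiff _ hn.1 hn.2.1, hn.2.2, not_lt] at h
    exact h

end Polynomial

/-! ### Polynomial approximation and the common limit -/

/-- Continuous rewards are uniform limits of polynomial ones. -/
lemma exists_polyReward_near {R : Ω → G.X → G.Y → ℝ}
    (hR : ∀ ω, Continuous fun a : G.X × G.Y => R ω a.1 a.2) {ε : ℝ} (hε : 0 < ε) :
    ∃ P, ∀ ω x y, |R ω x y - G.polyReward P ω x y| ≤ ε := by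
  let c : Fin p ⊕ Fin q → C(G.X × G.Y, ℝ) := Sum.elim
    (fun i => ⟨fun a => (a.1 : Fin p → ℝ) i,
      (continuous_apply i).comp (continuous_subtype_val.comp continuous_fst)⟩)
    fun j => ⟨fun a => (a.2 : Fin q → ℝ) j,
      (continuous_apply j).comp (continuous_subtype_val.comp continuous_snd)⟩
  have heval : ∀ (P : MvPolynomial (Fin p ⊕ Fin q) ℝ) (a : G.X × G.Y), MvPolynomial.aeval c P a =
      MvPolynomial.eval (Sum.elim (a.1 : Fin p → ℝ) (a.2 : Fin q → ℝ)) P := by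
    intro P a
    induction P using MvPolynomial.induction_on with
    | C r => simp
    | add P Q hP hQ => simp [hP, hQ]
    | mul_X P i hP =>
      rw [map_mul, map_mul, ContinuousMap.mul_apply, hP]
      rcases i with i | j <;> simp [c]
  -- Polynomials in the coordinates form a subalgebra of continuous functions separating points, as
  -- Stone–Weierstrass requires.
  have hsep : (MvPolynomial.aeval (R := ℝ) c).range.SeparatesPoints := by
    intro a b hab
    by_contra! h
    have h' : ∀ i, c i a = c i b := fun i =>
      h _ ⟨c i, ⟨MvPolynomial.X i, by simp⟩, rfl⟩
    refine hab (Prod.ext (Subtype.ext (funext fun i => ?_)) (Subtype.ext (funext fun j => ?_)))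
    · exact h' (Sum.inl i)
    · exact h' (Sum.inr j)
  have h : ∀ ω, ∃ P : MvPolynomial (Fin p ⊕ Fin q) ℝ, ∀ x y, |R ω x y -
      MvPolynomial.eval (Sum.elim (x : Fin p → ℝ) (y : Fin q → ℝ)) P| ≤ ε := by
    intro ω
    obtain ⟨⟨g, P, rfl⟩, hg⟩ :=
      ContinuousMap.exists_mem_subalgebra_near_continuous_of_separatesPoints _ hsep _ (hR ω) ε hε
    refine ⟨P, fun x y => ?_⟩
    rw [abs_sub_comm, ← heval P (x, y)]
    exact (hg (x, y)).le
  choose P hP using h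
  exact ⟨P, hP⟩

/-- The total values per stage and the discounted values have the same limit. -/
theorem exists_common_limit (hX : G.X ∈ O.sets p) (hY : G.Y ∈ O.sets q)
    (hdef : ∀ ω ω' : Ω, O.DefinableFun fun x y => G.ρ ω x y ω')
    (hsep : ∀ ω ω' : Ω, IsSeparableFun fun x y => G.ρ ω x y ω') {R : Ω → G.X → G.Y → ℝ}
    (hR : ∀ ω, Continuous fun a : G.X × G.Y => R ω a.1 a.2) {V : ℕ → Ω → ℝ} {w : ℝ → Ω → ℝ}
    (hV : G.IsTotalValue R V)
    (hw : ∀ lam, 0 < lam → lam ≤ 1 → G.IsDiscValue R lam (w lam)) :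
    ∃ L, Tendsto (fun n ω => V n ω / n) atTop (𝓝 L) ∧ Tendsto w (𝓝[>] 0) (𝓝 L) := by
  have happrox : ∀ ε > 0, ∃ L : Ω → ℝ, (∀ᶠ n : ℕ in atTop, dist (fun ω => V n ω / n) L < ε) ∧
      ∀ᶠ x in 𝓝[>] (0 : ℝ), dist (w x) L < ε := by
    intro ε hε
    obtain ⟨P, hP⟩ := exists_polyReward_near hR (half_pos hε)
    obtain ⟨V', hV'⟩ := exists_isTotalValue (G := G) (continuous_polyReward P)
    obtain ⟨w', hw'⟩ := exists_isDiscValue_family (G := G) (continuous_polyReward P)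
    have hD := defPred_isDiscValue hX hY hdef hsep P
    obtain ⟨L, hL⟩ := exists_tendsto_discValue hw' hD
    have hVL := hV'.tendsto hw' hL (eventually_monotone_discValue hw' hD)
    refine ⟨L, ?_, ?_⟩
    · filter_upwards [(Metric.tendsto_nhds.1 hVL) _ (half_pos hε), eventually_gt_atTop 0]
        with n h hn
      have hn' : (0 : ℝ) < n := by exact_mod_cast hn
      have h1 : dist (fun ω => V n ω / n) (fun ω => V' n ω / n) ≤ ε / 2 := by
        refine (dist_pi_le_iff (half_pos hε).le).2 fun ω => ?_
        rw [Real.dist_eq, ← sub_div, abs_div, abs_of_pos hn', div_le_iff₀ hn', mul_comm]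
        exact (norm_le_pi_norm (V n - V' n) ω).trans
          (hV.norm_sub_le hV' (half_pos hε).le hP n)
      linarith [dist_triangle (fun ω => V n ω / n) (fun ω => V' n ω / n) L]
    · filter_upwards [(Metric.tendsto_nhds.1 hL) _ (half_pos hε),
        (Ioc_mem_nhdsGT one_pos : Ioc (0 : ℝ) 1 ∈ 𝓝[>] 0)] with x h hx
      have h1 : dist (w x) (w' x) ≤ ε / 2 := by
        rw [dist_eq_norm]
        exact (hw x hx.1 hx.2).norm_sub_le hx.1 hx.2 (hw' x hx.1 hx.2) (half_pos hε).le hP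
      linarith [dist_triangle (w x) (w' x) L]
  -- The limits found for the approximating rewards vary with `ε`. The join of the two image filters
  -- is Cauchy, so completeness gives convergence of both families and equality of their limits at
  -- once.
  have hcauchy : Cauchy (map (fun (n : ℕ) ω => V n ω / n) atTop ⊔ map w (𝓝[>] (0 : ℝ))) := by
    rw [Metric.cauchy_iff]
    refine ⟨inferInstance, fun ε hε => ?_⟩
    obtain ⟨L, h1, h2⟩ := happrox (ε / 2) (half_pos hε)
    refine ⟨Metric.ball L (ε / 2), ⟨h1, h2⟩, fun x hx y hy => ?_⟩
    linarith [dist_triangle_right x y L, Metric.mem_ball.1 hx, Metric.mem_ball.1 hy]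
  obtain ⟨L, hL⟩ := CompleteSpace.complete hcauchy
  exact ⟨L, le_sup_left.trans hL, le_sup_right.trans hL⟩

end StochasticGame

theorem theorem4p3 {Ω : Type*} [Fintype Ω] [MeasurableSpace Ω] [MeasurableSingletonClass Ω]
    {p q : ℕ} (O : OMinStructure) (G : StochasticGame Ω p q)
    (hX : G.X ∈ O.sets p) (hY : G.Y ∈ O.sets q)
    (hdef : ∀ ω ω' : Ω, O.DefinableFun fun x y => G.ρ ω x y ω')
    (hsep : ∀ ω ω' : Ω, IsSeparableFun fun x y => G.ρ ω x y ω') :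
    ∃ (v : ℕ → Ω → ℝ) (w : ℝ → Ω → ℝ) (vlim : Ω → ℝ),
      (∀ n : ℕ, 1 ≤ n → ∀ ω, StochasticGame.IsValue (G.payoffN n ω) (v n ω)) ∧
      (∀ lam : ℝ, 0 < lam → lam ≤ 1 →
        ∀ ω, StochasticGame.IsValue (G.payoffDisc lam ω) (w lam ω)) ∧
      Tendsto v atTop (𝓝 vlim) ∧
      Tendsto w (𝓝[>] 0) (𝓝 vlim) := by
  obtain ⟨V, hV⟩ := StochasticGame.exists_isTotalValue G.continuous_g
  obtain ⟨w, hw⟩ := StochasticGame.exists_isDiscValue_family G.continuous_g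
  obtain ⟨L, hVL, hwL⟩ :=
    StochasticGame.exists_common_limit hX hY hdef hsep G.continuous_g hV hw
  exact ⟨fun n ω => V n ω / n, w, L,
    fun n hn ω => StochasticGame.isValue_payoffN hV.zero hV.succ hn ω,
    fun lam h0 h1 ω => StochasticGame.isValue_payoffDisc h0 h1 (hw lam h0 h1) ω, hVL, hwL⟩
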